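/- Let $X=\{u(1+i)+v(1-i) : u,v\in\mathbb R,\ -\tfrac12\le u,v<\tfrac12\}\subset\mathbb C$, with closure $\overline X$ and interior $X^{o}$. For $0\le k<4$ put $L(i^k(1+i))=\{i^k(1+i)m: m\in\mathbb Z_{>0}\}$ and $L(i^k2)=\{i^k(m(1+i)+l(1-i)): m,l\in\mathbb Z_{>0}\}$; these eight sets partition $(1+i)\mathbb Z[i]\setminus\{0\}$. For $w\in(1+i)\mathbb Z[i]$ let $Q_0=\overline X$; for $w\in L(i^k(1+i))$ let $$Q_w=(X^{o}+w)\cup\{u i^k(1+i)-\tfrac12 i^k(1-i)+w: -\tfrac12<u\le\tfrac12\}\cup\{\tfrac12 i^k(1+i)+u i^k(1-i)+w: -\tfrac12\le u\le\tfrac12\}\cup\{u i^k(1+i)+\tfrac12 i^k(1-i)+w: -\tfrac12<u\le\tfrac12\};$$ and for $w\in L(i^k2)$ let $$Q_w=(X^{o}+w)\cup\{u i^k(1+i)+\tfrac12 i^k(1-i)+w: -\tfrac12<u\le\tfrac12\}\cup\{\tfrac12 i^k(1+i)+u i^k(1-i)+w: -\tfrac12<u\le\tfrac12\}.$$ For $z\in\mathbb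 C\setminus\mathbb Z[i]$ let $\lfloor z\rfloor_H$ be the unique $w\in(1+i)\mathbb Z[i]$ with $z\in Q_w$; for $z\in\mathbb Z[i]$ let $\lfloor z\rfloor_H=z$. Define $T_H(z)=\frac1z-\lfloor\frac1z\rfloor_H$ for $z\ne0$ and $T_H(0)=0$. For $\alpha\in\overline X$ the Hurwitz orbit of $\alpha$ is the sequence $\alpha_{(1)}=\alpha$, $\alpha_{(n+1)}=T_H(\alpha_{(n)})$ as long as $\alpha_{(n)}\neq0$; it terminates when $\alpha_{(n)}=0$. It is purely periodic if it is infinite and there is $p\ge1$ with $\alpha_{(n+p)}=\alpha_{(n)}$ for all $n\ge1$. For $1\le j\le4$ define - $X_j=\{z\in X: |z-i^{k+j-1}(1+i)/2|>\sqrt2/2 \text{ for } k=0,1,2\}$ and $X_{j+4}=\{z\in X: |z-i^{k+j-1}(1-i)/2|<\sqrt2/2\text{ for }k=0,1\}$; - $W_j=\{z\in\mathbb C: |z|>1,\ |z-i^{j-1}(1-i)|\ge1\}$ and $W_{j+4}=\{z\in\mathbb C:|z|>1,\ |z-i^{k+j-1}(1-i)|\ge1\text{ for }k=0,1\}$; -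 $K_j=\{z\in\mathbb C: |z-i^{j-1}(\tfrac12-\tfrac12i)|=\sqrt2/2,\ |z|\le1\}$ and $K_j'=\{z\in\mathbb C: |z-i^{j-1}(\tfrac12-\tfrac12i)|=\sqrt2/2,\ |z|>1\}$; - $Y_j=\{i^{j-1}(s-it): s,t\in\mathbb R,\ s+t=1,\ 0\le s\le1\}$ and $Y_j'=\{i^{j-1}(s-it): s,t\in\mathbb R,\ s+t=1,\ s\le0\text{ or }s\ge1\}$. Let $N_1=\bigcup_{j=1}^{8}(X_j\times W_j)\cup\bigcup_{j=1}^4(Y_j\times Y_j')\cup\bigcup_{j=1}^4(K_j\times K_j')$. **Theorem.** For every $\alpha\in\overline X$, the Hurwitz orbit of $\alpha$ is purely periodic if and only if $\alpha$ is a quadratic irrational over $\mathbb Q(i)$ (that is, of degree exactly $2$ over $\mathbb Q(i)$) and $(\alpha,\alpha')\in N_1$, where $\alpha'$ denotes the conjugate of $\alpha$ over $\mathbb Q(i)$, i.e. the other root of its minimal polynomial. -/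

import Mathlib

open Complex

noncomputable section

namespace JHurwitz

/-- The half-open square `X = {u(1+i) + v(1-i) : -1/2 ≤ u, v < 1/2}`. -/
def X : Set ℂ :=
  {z | ∃ u v : ℝ, -1 / 2 ≤ u ∧ u < 1 / 2 ∧ -1 / 2 ≤ v ∧ v < 1 / 2 ∧
    z = u * (1 + I) + v * (1 - I)}

/-- The ring `ℤ[i]` inside `ℂ`. -/
def gaussInt : Set ℂ := {z | ∃ m n : ℤ, z = m + n * I}

/-- The ideal `(1+i)ℤ[i]` inside `ℂ`. -/
def lattice : Set ℂ := {w | ∃ g ∈ gaussInt, w = (1 + I) * g}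

/-- `L(i^k(1+i)) = i^k(1+i)ℤ_{>0}`. -/
def Ldiag (k : Fin 4) : Set ℂ :=
  {w | ∃ m : ℤ, 0 < m ∧ w = I ^ (k : ℕ) * (1 + I) * m}

/-- `L(i^k 2) = {i^k(m(1+i) + l(1-i)) : m, l ∈ ℤ_{>0}}`. -/
def Ltwo (k : Fin 4) : Set ℂ :=
  {w | ∃ m l : ℤ, 0 < m ∧ 0 < l ∧ w = I ^ (k : ℕ) * (m * (1 + I) + l * (1 - I))}

/-- The cell `Q_w` when `w ∈ L(i^k(1+i))`: the open square around `w` and three of its edges. -/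
def Qdiag (k : Fin 4) (w : ℂ) : Set ℂ :=
  {z | z - w ∈ interior X} ∪
  {z | ∃ u : ℝ, -1 / 2 < u ∧ u ≤ 1 / 2 ∧
    z = u * I ^ (k : ℕ) * (1 + I) - 1 / 2 * I ^ (k : ℕ) * (1 - I) + w} ∪
  {z | ∃ u : ℝ, -1 / 2 ≤ u ∧ u ≤ 1 / 2 ∧
    z = 1 / 2 * I ^ (k : ℕ) * (1 + I) + u * I ^ (k : ℕ) * (1 - I) + w} ∪
  {z | ∃ u : ℝ, -1 / 2 < u ∧ u ≤ 1 / 2 ∧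
    z = u * I ^ (k : ℕ) * (1 + I) + 1 / 2 * I ^ (k : ℕ) * (1 - I) + w}

/-- The cell `Q_w` when `w ∈ L(i^k 2)`: the open square around `w` and two of its edges. -/
def Qtwo (k : Fin 4) (w : ℂ) : Set ℂ :=
  {z | z - w ∈ interior X} ∪
  {z | ∃ u : ℝ, -1 / 2 < u ∧ u ≤ 1 / 2 ∧
    z = u * I ^ (k : ℕ) * (1 + I) + 1 / 2 * I ^ (k : ℕ) * (1 - I) + w} ∪
  {z | ∃ u : ℝ, -1 / 2 < u ∧ u ≤ 1 / 2 ∧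
    z = 1 / 2 * I ^ (k : ℕ) * (1 + I) + u * I ^ (k : ℕ) * (1 - I) + w}

/-- The cell `Q_w`; for `w ∈ (1+i)ℤ[i]` exactly one of the nine cases
`w = 0`, `w ∈ L(i^k(1+i))`, `w ∈ L(i^k 2)` occurs. -/
def Q (w : ℂ) : Set ℂ :=
  {z | (w = 0 ∧ z ∈ closure X) ∨
    (∃ k, w ∈ Ldiag k ∧ z ∈ Qdiag k w) ∨ (∃ k, w ∈ Ltwo k ∧ z ∈ Qtwo k w)}

open Classical in
/-- `⌊z⌋_H`: equal to `z` on `ℤ[i]`, and otherwise the (unique) `w ∈ (1+i)ℤ[i]`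
with `z ∈ Q_w`. -/
def floorH (z : ℂ) : ℂ :=
  if z ∈ gaussInt then z
  else if h : ∃ w, w ∈ lattice ∧ z ∈ Q w then h.choose else 0

open Classical in
/-- The transformation `T_H`. -/
def TH (z : ℂ) : ℂ := if z = 0 then 0 else 1 / z - floorH (1 / z)

open Classical in
/-- One step of the algorithm: `z ↦ T_H(z)` if `z ≠ 0`; the algorithm stops at `0`
(`none` stands for "no further term"). -/
def step (z : ℂ) : Option ℂ := if z = 0 then none else some (TH z)

/-- The possibly finite sequence `α_(1) = α, α_(2), …`, with the index shifted by one: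
`orbit α n` is `α_(n+1)`, and is `none` once the sequence has terminated. -/
def orbit (α : ℂ) : ℕ → Option ℂ
  | 0 => some α
  | n + 1 => (orbit α n).bind step

/-- The sequence is infinite and purely periodic. -/
def PurelyPeriodic (α : ℂ) : Prop :=
  (∀ n, orbit α n ≠ none) ∧ ∃ p : ℕ, 0 < p ∧ ∀ n, orbit α (n + p) = orbit α n

/-- The field `ℚ(i)` as a subfield of `ℂ`. -/
abbrev Qi : IntermediateField ℚ ℂ := IntermediateField.adjoin ℚ {I}

/-- `α` is a quadratic irrational over `ℚ(i)`. -/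
def IsQuadraticIrrational (α : ℂ) : Prop :=
  IsIntegral Qi α ∧ (minpoly Qi α).natDegree = 2

/-- `β` is the conjugate `α'` of the quadratic irrational `α`:
the root different from `α` of the minimal polynomial of `α` over `ℚ(i)`. -/
def IsConjugate (α β : ℂ) : Prop := IsConjRoot Qi α β ∧ β ≠ α

/-! In the families below the index `j : Fin 4` stands for the usual index `j + 1`
running through `1, …, 4`. -/

/-- The regions `X_1, …, X_4`. -/
def XA (j : Fin 4) : Set ℂ :=
  {z | z ∈ X ∧ ∀ k : ℕ, k ≤ 2 →
    ‖z - I ^ (k + (j : ℕ)) * (1 + I) / 2‖ > √2 / 2}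

/-- The regions `X_5, …, X_8`. -/
def XB (j : Fin 4) : Set ℂ :=
  {z | z ∈ X ∧ ∀ k : ℕ, k ≤ 1 →
    ‖z - I ^ (k + (j : ℕ)) * (1 - I) / 2‖ < √2 / 2}

/-- The regions `W_1, …, W_4`. -/
def WA (j : Fin 4) : Set ℂ :=
  {z | ‖z‖ > 1 ∧ ‖z - I ^ (j : ℕ) * (1 - I)‖ ≥ 1}

/-- The regions `W_5, …, W_8`. -/
def WB (j : Fin 4) : Set ℂ :=
  {z | ‖z‖ > 1 ∧ ∀ k : ℕ, k ≤ 1 → ‖z - I ^ (k + (j : ℕ)) * (1 - I)‖ ≥ 1}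

/-- The circular arcs `K_j`. -/
def K (j : Fin 4) : Set ℂ :=
  {z | ‖z - I ^ (j : ℕ) * (1 / 2 - 1 / 2 * I)‖ = √2 / 2 ∧ ‖z‖ ≤ 1}

/-- The complementary circular arcs `K_j'`. -/
def K' (j : Fin 4) : Set ℂ :=
  {z | ‖z - I ^ (j : ℕ) * (1 / 2 - 1 / 2 * I)‖ = √2 / 2 ∧ ‖z‖ > 1}

/-- The edges `Y_j` of the square. -/
def Y (j : Fin 4) : Set ℂ :=
  {z | ∃ s t : ℝ, s + t = 1 ∧ 0 ≤ s ∧ s ≤ 1 ∧ z = I ^ (j : ℕ) * (s - I * t)}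

/-- The sets `Y_j'`: the two closed half-lines that complement the edge `Y_j` in its line. -/
def Y' (j : Fin 4) : Set ℂ :=
  {z | ∃ s t : ℝ, s + t = 1 ∧ (s ≤ 0 ∨ 1 ≤ s) ∧ z = I ^ (j : ℕ) * (s - I * t)}

/-- The set `N_1`. -/
def N1 : Set (ℂ × ℂ) :=
  (⋃ j, XA j ×ˢ WA j) ∪ (⋃ j, XB j ×ˢ WB j) ∪ (⋃ j, Y j ×ˢ Y' j) ∪ (⋃ j, K j ×ˢ K' j)

end JHurwitz

end

noncomputable section

namespace JHurwitz

open ComplexConjugate Polynomial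

/-! In the coordinates `cu`, `cv` along 1+i and 1-i, `floorH` rounds each coordinate of a point
outside ℤ[i] to a nearest integer, ties going towards zero. The proof studies the natural extension
`pairMap`, which applies the Möbius map z ↦ 1/z - w selected by the first entry to both entries of a
pair. Its domain is `InDual`, a closed condition on z' that depends on z only through the discs with
diameter [0, d], d = ±1±i, that contain z. The map preserves this condition (`InDual.map`), and
where |z'| > 1 it is injective, because the image determines w (`InDual.rounding_unique`). The
conjugate of a point on a circle or line over ℚ(i) lies on the same curve (`ConjPair.reflect`). This
settles the boundary cases and identifies `InDual` with N₁ on conjugate pairs (`mem_N1_iff`).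

If (α, α') lies in the domain, `pairMap` keeps the discriminant of its quadratic form over ℤ[i], and
only finitely many pairs in the domain share a discriminant (`finite_reduced`). An injective
self-map of a finite set is a permutation, so α is purely periodic.

Conversely, let α be purely periodic. The products of the first n orbit terms are combinations of 1
and α over ℤ[i] with strictly decreasing norms, so α is not in ℚ(i), and periodicity gives a
quadratic equation. Iterating `pairMap` from (α, 3), one period at a time, keeps the second entry in
the closed fibre over α and moves it to α', so α' lies in that fibre (`inDual_of_periodic`). -/

/-! ### Conjugate pairs over ℚ(i). -/

/-- The field of Gaussian rationals, given by coordinates. -/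
def gaussRat : IntermediateField ℚ ℂ where
  carrier := {z | ∃ r s : ℚ, z = r + s * I}
  mul_mem' := by
    rintro _ _ ⟨r, s, rfl⟩ ⟨r', s', rfl⟩
    refine ⟨r * r' - s * s', r * s' + s * r', ?_⟩
    push_cast
    linear_combination (s * s' : ℂ) * I_mul_I
  add_mem' := by
    rintro _ _ ⟨r, s, rfl⟩ ⟨r', s', rfl⟩
    exact ⟨r + r', s + s', by push_cast; ring⟩
  algebraMap_mem' r := ⟨r, 0, by simp⟩
  inv_mem' := by
    rintro _ ⟨r, s, rfl⟩
    refine ⟨r / (r ^ 2 + s ^ 2), -s / (r ^ 2 + s ^ 2), ?_⟩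
    by_cases h : (r : ℂ) + s * I = 0
    · have hr := congrArg Complex.re h
      have hs := congrArg Complex.im h
      simp at hr hs
      simp [hr, hs]
    · have h2 : ((r : ℂ) ^ 2 + s ^ 2) ≠ 0 := by
        norm_cast
        intro h0
        apply h
        have hr : r = 0 := by nlinarith [sq_nonneg r, sq_nonneg s]
        have hs : s = 0 := by nlinarith [sq_nonneg r, sq_nonneg s]
        simp [hr, hs]
      apply inv_eq_of_mul_eq_one_left
      push_cast
      field_simp
      linear_combination (-s ^ 2 : ℂ) * I_mul_I

theorem mem_Qi_iff {z : ℂ} : z ∈ Qi ↔ ∃ r s : ℚ, z = r + s * I := by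
  constructor
  · intro h
    have : Qi ≤ gaussRat := by
      rw [IntermediateField.adjoin_le_iff]
      rintro _ rfl
      exact ⟨0, 1, by simp⟩
    exact this h
  · rintro ⟨r, s, rfl⟩
    have hI : I ∈ Qi := IntermediateField.subset_adjoin _ _ rfl
    exact add_mem (SubfieldClass.ratCast_mem _ _) (mul_mem (SubfieldClass.ratCast_mem _ _) hI)

theorem I_mem_Qi : I ∈ Qi := mem_Qi_iff.2 ⟨0, 1, by simp⟩

theorem conj_mem_Qi {z : ℂ} (h : z ∈ Qi) : conj z ∈ Qi := by
  obtain ⟨r, s, rfl⟩ := mem_Qi_iff.1 h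
  exact mem_Qi_iff.2 ⟨r, -s, by simp⟩

theorem gaussInt_subset_Qi {z : ℂ} (h : z ∈ gaussInt) : z ∈ Qi := by
  obtain ⟨m, n, rfl⟩ := h
  exact mem_Qi_iff.2 ⟨m, n, by simp⟩

/-- `z` and `z'` are the two roots of an irreducible quadratic polynomial over `ℚ(i)`. -/
structure ConjPair (z z' : ℂ) : Prop where
  irrational : z ∉ Qi
  add_mem_Qi : z + z' ∈ Qi
  mul_mem_Qi : z * z' ∈ Qi

namespace ConjPair

variable {z z' : ℂ}

theorem symm (h : ConjPair z z') : ConjPair z' z where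
  irrational h' := h.irrational (by simpa using sub_mem h.add_mem_Qi h')
  add_mem_Qi := add_comm z z' ▸ h.add_mem_Qi
  mul_mem_Qi := mul_comm z z' ▸ h.mul_mem_Qi

theorem ne_zero (h : ConjPair z z') : z ≠ 0 := fun h0 => h.irrational (h0 ▸ zero_mem Qi)

theorem ne (h : ConjPair z z') : z ≠ z' := by
  intro he
  apply h.irrational
  have h2 := h.add_mem_Qi
  rw [← he, ← two_mul] at h2
  have : (2 : ℂ)⁻¹ * (2 * z) ∈ Qi := mul_mem (inv_mem (ofNat_mem Qi 2)) h2
  simpa using this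

/-- A quadratic equation over `ℚ(i)` satisfied by `z` is satisfied by its conjugate. -/
theorem root (h : ConjPair z z') {p q r : ℂ} (hp : p ∈ Qi) (hq : q ∈ Qi) (hr : r ∈ Qi)
    (h0 : p * z ^ 2 + q * z + r = 0) : p * z' ^ 2 + q * z' + r = 0 := by
  have h1 : (p * (z + z') + q) * z = p * (z * z') - r := by linear_combination h0
  have hA : p * (z + z') + q ∈ Qi := add_mem (mul_mem hp h.add_mem_Qi) hq
  have hB : p * (z * z') - r ∈ Qi := sub_mem (mul_mem hp h.mul_mem_Qi) hr
  have hz : p * (z + z') + q = 0 := by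
    by_contra hne
    apply h.irrational
    have : z = (p * (z * z') - r) / (p * (z + z') + q) := by
      rw [← h1]; field_simp
    rw [this]
    exact div_mem hB hA
  have h2 : p * (z * z') - r = 0 := by rw [← h1, hz, zero_mul]
  linear_combination z' * hz - h2

/-- If `z` lies on a circle or line with coefficients in `ℚ(i)`, so does its conjugate. -/
theorem reflect (h : ConjPair z z') {A B C : ℂ} (hA : A ∈ Qi) (hB : B ∈ Qi) (hC : C ∈ Qi)
    (hd : A * C ≠ B * conj B) (h0 : A * (z * conj z) + B * z + conj B * conj z + C = 0) :
    A * (z' * conj z') + B * z' + conj B * conj z' + C = 0 := by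
  have hs := conj_mem_Qi h.add_mem_Qi
  have hn := conj_mem_Qi h.mul_mem_Qi
  have hB' := conj_mem_Qi hB
  rw [map_add] at hs
  rw [map_mul] at hn
  -- The equation `h0` gives conj z = -(Bz + C)/(Az + conj B). Inserting this into the conjugated
  -- minimal polynomial yields a quadratic over ℚ(i) vanishing at z, hence at z', where it factors
  -- as in `key'`.
  have key := h.root (p := B ^ 2 + (conj z + conj z') * (A * B) + conj z * conj z' * A ^ 2)
    (q := 2 * (B * C) + (conj z + conj z') * (A * C + B * conj B)
      + conj z * conj z' * (2 * (A * conj B)))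
    (r := C ^ 2 + (conj z + conj z') * (C * conj B) + conj z * conj z' * (conj B) ^ 2)
    (add_mem (add_mem (pow_mem hB 2) (mul_mem hs (mul_mem hA hB)))
      (mul_mem hn (pow_mem hA 2)))
    (add_mem (add_mem (mul_mem (ofNat_mem Qi 2) (mul_mem hB hC))
      (mul_mem hs (add_mem (mul_mem hA hC) (mul_mem hB hB'))))
      (mul_mem hn (mul_mem (ofNat_mem Qi 2) (mul_mem hA hB'))))
    (add_mem (add_mem (pow_mem hC 2) (mul_mem hs (mul_mem hC hB')))
      (mul_mem hn (pow_mem hB' 2)))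
    (by linear_combination (B * z + C + conj z' * (A * z + conj B)) * h0)
  have key' : (B * z' + C + conj z * (A * z' + conj B)) *
      (A * (z' * conj z') + B * z' + conj B * conj z' + C) = 0 := by
    linear_combination key
  -- The spurious factor vanishes only if A conj z + B = 0, which would make the circle degenerate.
  refine (mul_eq_zero.1 key').resolve_left fun h1 => hd ?_
  have h2 : (z - z') * (A * conj z + B) = 0 := by linear_combination h0 - h1
  have h3 : A * conj z + B = 0 := (mul_eq_zero.1 h2).resolve_left (sub_ne_zero.2 h.ne)
  linear_combination A * h0 - (A * z + conj B) * h3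

/-- Inversion followed by an integral translation preserves conjugate pairs. -/
theorem inv_sub (h : ConjPair z z') {w : ℂ} (hw : w ∈ Qi) :
    ConjPair (1 / z - w) (1 / z' - w) := by
  have hz := h.ne_zero
  have hz' := h.symm.ne_zero
  have hx : 1 / z + 1 / z' ∈ Qi := by
    have : 1 / z + 1 / z' = (z + z') / (z * z') := by field_simp; ring
    rw [this]; exact div_mem h.add_mem_Qi h.mul_mem_Qi
  have hx' : 1 / z * (1 / z') ∈ Qi := by
    have : 1 / z * (1 / z') = (z * z')⁻¹ := by field_simp
    rw [this]; exact inv_mem h.mul_mem_Qi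
  refine ⟨fun h0 => h.irrational ?_, ?_, ?_⟩
  · have h1 : 1 / z ∈ Qi := by simpa using add_mem h0 hw
    simpa using inv_mem h1
  · have : 1 / z - w + (1 / z' - w) = (1 / z + 1 / z') - (w + w) := by ring
    rw [this]; exact sub_mem hx (add_mem hw hw)
  · have : (1 / z - w) * (1 / z' - w) = 1 / z * (1 / z') - w * (1 / z + 1 / z') + w * w := by ring
    rw [this]; exact add_mem (sub_mem hx' (mul_mem hw hx)) (mul_mem hw hw)

/-- The monic polynomial with roots `z` and `z'` is the minimal polynomial of `z`. -/
theorem minpoly_eq (h : ConjPair z z') :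
    IsIntegral Qi z ∧ minpoly Qi z =
      Polynomial.X ^ 2 - C (⟨z + z', h.add_mem_Qi⟩ : Qi) * Polynomial.X + C (⟨z * z', h.mul_mem_Qi⟩ : Qi) := by
  set g : Qi[X] := Polynomial.X ^ 2 - C (⟨z + z', h.add_mem_Qi⟩ : Qi) * Polynomial.X + C (⟨z * z', h.mul_mem_Qi⟩ : Qi)
    with hg
  have hdeg : g.natDegree = 2 := by rw [hg]; compute_degree!
  have hmon : g.Monic := by rw [hg]; monicity!
  have hroot : aeval z g = 0 := by
    simp only [hg, map_add, map_sub, map_mul, map_pow, aeval_X, aeval_C]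
    change z ^ 2 - (z + z') * z + z * z' = 0
    ring
  have hint : IsIntegral Qi z := ⟨g, hmon, hroot⟩
  refine ⟨hint, ?_⟩
  refine (Polynomial.eq_of_monic_of_dvd_of_natDegree_le (minpoly.monic hint) hmon
    (minpoly.dvd _ _ hroot) ?_).symm
  rw [hdeg]
  have h0 := minpoly.natDegree_pos hint
  have h1 : (minpoly Qi z).natDegree ≠ 1 := by
    intro h1
    obtain ⟨y, hy⟩ := minpoly.natDegree_eq_one_iff.1 h1
    exact h.irrational (hy ▸ y.2)
  omega

theorem isQuadraticIrrational (h : ConjPair z z') : IsQuadraticIrrational z := by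
  refine ⟨h.minpoly_eq.1, ?_⟩
  rw [h.minpoly_eq.2]
  compute_degree!

theorem isConjugate (h : ConjPair z z') : IsConjugate z z' := by
  refine ⟨?_, h.ne.symm⟩
  unfold IsConjRoot
  rw [h.minpoly_eq.2, h.symm.minpoly_eq.2]
  congr 3
  · simp [add_comm]
  · simp [mul_comm]

end ConjPair

/-- Vieta's relations, from subtracting the two root equations and cancelling z' - z. -/
theorem IsQuadraticIrrational.conjPair {z z' : ℂ} (hz : IsQuadraticIrrational z)
    (h : IsConjugate z z') : ConjPair z z' := by
  obtain ⟨hint, hdeg⟩ := hz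
  obtain ⟨hc, hne⟩ := h
  have hmon := minpoly.monic hint
  have hlead : (minpoly Qi z).coeff 2 = 1 := by rw [← hdeg]; exact hmon
  have e1 := minpoly.aeval Qi z
  have e2 : aeval z' (minpoly Qi z) = 0 := by
    rw [show minpoly Qi z = minpoly Qi z' from hc]; exact minpoly.aeval Qi z'
  rw [aeval_eq_sum_range, hdeg] at e1 e2
  simp only [Finset.sum_range_succ, Finset.sum_range_zero, hlead, Algebra.smul_def] at e1 e2
  set b : Qi := (minpoly Qi z).coeff 1
  set c : Qi := (minpoly Qi z).coeff 0
  change 0 + (c : ℂ) * z ^ 0 + (b : ℂ) * z ^ 1 + ((1 : Qi) : ℂ) * z ^ 2 = 0 at e1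
  change 0 + (c : ℂ) * z' ^ 0 + (b : ℂ) * z' ^ 1 + ((1 : Qi) : ℂ) * z' ^ 2 = 0 at e2
  rw [OneMemClass.coe_one] at e1 e2
  have h1 : (z' - z) * (z + z' + b) = 0 := by linear_combination e2 - e1
  have h2 := (mul_eq_zero.1 h1).resolve_left (sub_ne_zero.2 hne)
  have hs : z + z' = -(b : ℂ) := by linear_combination h2
  have hp : z * z' = (c : ℂ) := by linear_combination z * h2 - e1
  refine ⟨fun hz => ?_, hs ▸ neg_mem b.2, hp ▸ c.2⟩
  have : (minpoly Qi z).natDegree = 1 :=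
    minpoly.natDegree_eq_one_iff.2 ⟨⟨z, hz⟩, rfl⟩
  omega

/-! ### Coordinates along 1+i and 1-i. -/

/-- The coefficient of `1 + i` in the basis `1 + i, 1 - i`. -/
def cu (z : ℂ) : ℝ := (z.re + z.im) / 2

/-- The coefficient of `1 - i` in the basis `1 + i, 1 - i`. -/
def cv (z : ℂ) : ℝ := (z.re - z.im) / 2

theorem cu_add (z w : ℂ) : cu (z + w) = cu z + cu w := by simp [cu]; ring
theorem cv_add (z w : ℂ) : cv (z + w) = cv z + cv w := by simp [cv]; ring
theorem cu_sub (z w : ℂ) : cu (z - w) = cu z - cu w := by simp [cu]; ring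
theorem cv_sub (z w : ℂ) : cv (z - w) = cv z - cv w := by simp [cv]; ring

theorem eq_of_coords (z : ℂ) : z = cu z * (1 + I) + cv z * (1 - I) := by
  apply Complex.ext <;> simp [cu, cv] <;> ring

theorem cu_basis (u v : ℝ) : cu (u * (1 + I) + v * (1 - I)) = u := by simp [cu]; ring
theorem cv_basis (u v : ℝ) : cv (u * (1 + I) + v * (1 - I)) = v := by simp [cv]

theorem norm_sq_eq (z : ℂ) : ‖z‖ ^ 2 = 2 * (cu z ^ 2 + cv z ^ 2) := by
  rw [Complex.sq_norm, Complex.normSq_apply]; simp only [cu, cv]; ring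

/-- Inversion exchanges the two coordinates up to scaling, because 1/z = conj z/|z|² and conjugation
swaps 1+i and 1-i. -/
theorem cu_inv (z : ℂ) : cu (1 / z) = cv z / (2 * (cu z ^ 2 + cv z ^ 2)) := by
  rw [← norm_sq_eq, Complex.sq_norm]
  simp [cu, cv]; ring

theorem cv_inv (z : ℂ) : cv (1 / z) = cu z / (2 * (cu z ^ 2 + cv z ^ 2)) := by
  rw [← norm_sq_eq, Complex.sq_norm]
  simp [cu, cv]; ring

/-- The coordinates in the basis `1 + i, 1 - i` as a homeomorphism. -/
def coordHomeo : ℂ ≃ₜ ℝ × ℝ where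
  toFun z := (cu z, cv z)
  invFun p := p.1 * (1 + I) + p.2 * (1 - I)
  left_inv z := (eq_of_coords z).symm
  right_inv p := Prod.ext (cu_basis _ _) (cv_basis _ _)
  continuous_toFun := by unfold cu cv; fun_prop
  continuous_invFun := by fun_prop

theorem X_eq : X = coordHomeo ⁻¹' (Set.Ico (-1 / 2) (1 / 2) ×ˢ Set.Ico (-1 / 2) (1 / 2)) := by
  ext z
  constructor
  · rintro ⟨u, v, h1, h2, h3, h4, rfl⟩
    refine ⟨?_, ?_⟩
    · change cu _ ∈ _; rw [cu_basis]; exact ⟨h1, h2⟩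
    · change cv _ ∈ _; rw [cv_basis]; exact ⟨h3, h4⟩
  · rintro ⟨h1, h2⟩
    exact ⟨cu z, cv z, h1.1, h1.2, h2.1, h2.2, eq_of_coords z⟩

theorem mem_X {z : ℂ} :
    z ∈ X ↔ (-1 / 2 ≤ cu z ∧ cu z < 1 / 2) ∧ (-1 / 2 ≤ cv z ∧ cv z < 1 / 2) := by
  rw [X_eq]; rfl

theorem mem_closure_X {z : ℂ} :
    z ∈ closure X ↔ (-1 / 2 ≤ cu z ∧ cu z ≤ 1 / 2) ∧ (-1 / 2 ≤ cv z ∧ cv z ≤ 1 / 2) := by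
  rw [X_eq, ← Homeomorph.preimage_closure, closure_prod_eq, closure_Ico (by norm_num)]; rfl

theorem mem_interior_X {z : ℂ} :
    z ∈ interior X ↔ (-1 / 2 < cu z ∧ cu z < 1 / 2) ∧ (-1 / 2 < cv z ∧ cv z < 1 / 2) := by
  rw [X_eq, ← Homeomorph.preimage_interior, interior_prod_eq, interior_Ico]; rfl

/-! ### The Hurwitz floor as coordinatewise rounding. -/

/-- `m` is an integer nearest to `t`, the smaller one in absolute value in case of a tie. -/
structure NearestInt (t : ℝ) (m : ℤ) : Prop where
  lower : (m : ℝ) - 1 / 2 ≤ t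
  upper : t ≤ m + 1 / 2
  lower_tie : t = m - 1 / 2 → m ≤ 0
  upper_tie : t = m + 1 / 2 → 0 ≤ m

theorem exists_nearestInt (t : ℝ) : ∃ m, NearestInt t m := by
  have h1 := Int.floor_le t
  have h2 := Int.lt_floor_add_one t
  set n := ⌊t⌋
  rcases lt_trichotomy t (n + 1 / 2) with h | h | h
  · exact ⟨n, by linarith, by linarith, fun h' => by linarith, fun h' => by linarith⟩
  · by_cases hn : 0 ≤ n
    · exact ⟨n, by linarith, by linarith, fun h' => by linarith, fun _ => hn⟩
    · refine ⟨n + 1, ?_, ?_, fun _ => by omega, fun h' => ?_⟩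
      · push_cast; linarith
      · push_cast; linarith
      · push_cast at h'; linarith
  · refine ⟨n + 1, ?_, ?_, fun h' => ?_, fun h' => ?_⟩
    · push_cast; linarith
    · push_cast; linarith
    · push_cast at h'; linarith
    · push_cast at h'; linarith

theorem mem_lattice {w : ℂ} : w ∈ lattice ↔ ∃ m l : ℤ, w = m * (1 + I) + l * (1 - I) := by
  constructor
  · rintro ⟨_, ⟨a, b, rfl⟩, rfl⟩
    refine ⟨a, -b, ?_⟩
    push_cast
    linear_combination (b : ℂ) * I_mul_I
  · rintro ⟨m, l, rfl⟩
    refine ⟨_, ⟨m, -l, rfl⟩, ?_⟩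
    push_cast
    linear_combination (l : ℂ) * I_mul_I

theorem cu_int (m l : ℤ) : cu (m * (1 + I) + l * (1 - I)) = m := by
  exact_mod_cast cu_basis m l
theorem cv_int (m l : ℤ) : cv (m * (1 + I) + l * (1 - I)) = l := by
  exact_mod_cast cv_basis m l

theorem lattice_subset_gaussInt {w : ℂ} (h : w ∈ lattice) : w ∈ gaussInt := by
  obtain ⟨m, l, rfl⟩ := mem_lattice.1 h
  exact ⟨m + l, m - l, by push_cast; ring⟩

namespace NearestInt

theorem neg {t : ℝ} {m : ℤ} (h : NearestInt t m) : NearestInt (-t) (-m) where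
  lower := by push_cast; linarith [h.upper]
  upper := by push_cast; linarith [h.lower]
  lower_tie h' := by
    have := h.upper_tie (by push_cast at h'; linarith)
    omega
  upper_tie h' := by
    have := h.lower_tie (by push_cast at h'; linarith)
    omega

theorem of_pos {u : ℝ} {m : ℤ} (hm : 0 < m) (h1 : -1 / 2 < u) (h2 : u ≤ 1 / 2) :
    NearestInt (u + m) m :=
  ⟨by linarith, by linarith, fun h' => by linarith, fun _ => hm.le⟩

theorem of_abs_le {u : ℝ} (h1 : -1 / 2 ≤ u) (h2 : u ≤ 1 / 2) : NearestInt u 0 :=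
  ⟨by simp; linarith, by simp; linarith, fun _ => le_rfl, fun _ => le_rfl⟩

theorem lt_of_pos {t : ℝ} {m : ℤ} (h : NearestInt t m) (hm : 0 < m) : -1 / 2 < t - m := by
  refine lt_of_le_of_ne (by linarith [h.lower]) fun h' => ?_
  have := h.lower_tie (by linarith)
  omega

end NearestInt

/-- `w` is the point of `(1+i)ℤ[i]` obtained from `z` by rounding both coordinates. -/
def IsRounding (z w : ℂ) : Prop :=
  ∃ m l : ℤ, w = m * (1 + I) + l * (1 - I) ∧ NearestInt (cu z) m ∧ NearestInt (cv z) l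

theorem cu_I_mul (z : ℂ) : cu (I * z) = cv z := by simp [cu, cv]; ring
theorem cv_I_mul (z : ℂ) : cv (I * z) = -cu z := by simp [cu, cv]; ring

/-- Multiplication by i permutes the coordinates up to sign, and rounding with ties towards zero is
odd. This reduces the cells for all k to k = 0. -/
theorem IsRounding.I_mul {z w : ℂ} (h : IsRounding z w) : IsRounding (I * z) (I * w) := by
  obtain ⟨m, l, rfl, hm, hl⟩ := h
  refine ⟨l, -m, ?_, ?_, ?_⟩
  · push_cast
    linear_combination (m - l : ℂ) * I_mul_I
  · rwa [cu_I_mul]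
  · rw [cv_I_mul]; exact hm.neg

theorem IsRounding.I_pow_mul {z w : ℂ} (h : IsRounding z w) (k : ℕ) :
    IsRounding (I ^ k * z) (I ^ k * w) := by
  induction k with
  | zero => simpa using h
  | succ k ih => simpa only [pow_succ', mul_assoc] using ih.I_mul

theorem I_pow_mul_mem_interior_X {z : ℂ} (k : ℕ) : I ^ k * z ∈ interior X ↔ z ∈ interior X := by
  induction k with
  | zero => simp
  | succ k ih =>
    rw [← ih, pow_succ', mul_assoc]
    simp only [mem_interior_X, cu_I_mul, cv_I_mul]
    constructor <;> rintro ⟨⟨h1, h2⟩, h3, h4⟩ <;> refine ⟨⟨?_, ?_⟩, ?_, ?_⟩ <;> linarith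

theorem exists_rotation (k : ℕ) (z w : ℂ) : ∃ y, z = I ^ k * y + w :=
  ⟨(z - w) / I ^ k, by field_simp; ring⟩

theorem mem_Qdiag {k : Fin 4} {w z : ℂ} : z ∈ Qdiag k w ↔ ∃ u v : ℝ,
    (-1 / 2 < u ∧ u ≤ 1 / 2) ∧ (-1 / 2 ≤ v ∧ v ≤ 1 / 2) ∧
      z = I ^ (k : ℕ) * (u * (1 + I) + v * (1 - I)) + w := by
  constructor
  · rintro (((h | ⟨u, h1, h2, rfl⟩) | ⟨u, h1, h2, rfl⟩) | ⟨u, h1, h2, rfl⟩)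
    · obtain ⟨y, rfl⟩ := exists_rotation k z w
      rw [Set.mem_ofPred_eq, add_sub_cancel_right, I_pow_mul_mem_interior_X, mem_interior_X] at h
      exact ⟨cu y, cv y, ⟨h.1.1, h.1.2.le⟩, ⟨h.2.1.le, h.2.2.le⟩, by rw [← eq_of_coords]⟩
    · exact ⟨u, -1 / 2, ⟨h1, h2⟩, by norm_num, by push_cast; ring⟩
    · exact ⟨1 / 2, u, by norm_num, ⟨h1, h2⟩, by push_cast; ring⟩
    · exact ⟨u, 1 / 2, ⟨h1, h2⟩, by norm_num, by push_cast; ring⟩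
  · rintro ⟨u, v, ⟨h1, h2⟩, ⟨h3, h4⟩, rfl⟩
    rcases eq_or_lt_of_le h2 with rfl | h2
    · exact Or.inl (Or.inr ⟨v, h3, h4, by push_cast; ring⟩)
    rcases eq_or_lt_of_le h3 with rfl | h3
    · exact Or.inl (Or.inl (Or.inr ⟨u, h1, h2.le, by push_cast; ring⟩))
    rcases eq_or_lt_of_le h4 with rfl | h4
    · exact Or.inr ⟨u, h1, h2.le, by push_cast; ring⟩
    · refine Or.inl (Or.inl (Or.inl ?_))
      rw [Set.mem_ofPred_eq, add_sub_cancel_right, I_pow_mul_mem_interior_X, mem_interior_X,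
        cu_basis, cv_basis]
      exact ⟨⟨h1, h2⟩, h3, h4⟩

theorem mem_Qtwo {k : Fin 4} {w z : ℂ} : z ∈ Qtwo k w ↔ ∃ u v : ℝ,
    (-1 / 2 < u ∧ u ≤ 1 / 2) ∧ (-1 / 2 < v ∧ v ≤ 1 / 2) ∧
      z = I ^ (k : ℕ) * (u * (1 + I) + v * (1 - I)) + w := by
  constructor
  · rintro ((h | ⟨u, h1, h2, rfl⟩) | ⟨u, h1, h2, rfl⟩)
    · obtain ⟨y, rfl⟩ := exists_rotation k z w
      rw [Set.mem_ofPred_eq, add_sub_cancel_right, I_pow_mul_mem_interior_X, mem_interior_X] at h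
      exact ⟨cu y, cv y, ⟨h.1.1, h.1.2.le⟩, ⟨h.2.1, h.2.2.le⟩, by rw [← eq_of_coords]⟩
    · exact ⟨u, 1 / 2, ⟨h1, h2⟩, by norm_num, by push_cast; ring⟩
    · exact ⟨1 / 2, u, by norm_num, ⟨h1, h2⟩, by push_cast; ring⟩
  · rintro ⟨u, v, ⟨h1, h2⟩, ⟨h3, h4⟩, rfl⟩
    rcases eq_or_lt_of_le h2 with rfl | h2
    · exact Or.inr ⟨v, h3, h4, by push_cast; ring⟩
    rcases eq_or_lt_of_le h4 with rfl | h4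
    · exact Or.inl (Or.inr ⟨u, h1, h2.le, by push_cast; ring⟩)
    · refine Or.inl (Or.inl ?_)
      rw [Set.mem_ofPred_eq, add_sub_cancel_right, I_pow_mul_mem_interior_X, mem_interior_X,
        cu_basis, cv_basis]
      exact ⟨⟨h1, h2⟩, h3, h4⟩

/-- The edges belonging to each cell are exactly those which the tie rule assigns to it: a positive
coordinate of w keeps its outer edge, a zero coordinate keeps both. -/
theorem isRounding_of_mem_Q {z w : ℂ} (hz : z ∈ Q w) : IsRounding z w := by
  rcases hz with ⟨rfl, h⟩ | ⟨k, ⟨m, hm, rfl⟩, h⟩ | ⟨k, ⟨m, l, hm, hl, rfl⟩, h⟩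
  · rw [mem_closure_X] at h
    exact ⟨0, 0, by simp, .of_abs_le h.1.1 h.1.2, .of_abs_le h.2.1 h.2.2⟩
  · obtain ⟨u, v, hu, hv, rfl⟩ := mem_Qdiag.1 h
    rw [mul_assoc, ← mul_add]
    refine IsRounding.I_pow_mul ⟨m, 0, by push_cast; ring, ?_, ?_⟩ k
    · rw [show (u * (1 + I) + v * (1 - I) + (1 + I) * m : ℂ)
        = (u + m : ℝ) * (1 + I) + v * (1 - I) by push_cast; ring, cu_basis]
      exact .of_pos hm hu.1 hu.2
    · rw [show (u * (1 + I) + v * (1 - I) + (1 + I) * m : ℂ)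
        = (u + m : ℝ) * (1 + I) + v * (1 - I) by push_cast; ring, cv_basis]
      exact .of_abs_le hv.1 hv.2
  · obtain ⟨u, v, hu, hv, rfl⟩ := mem_Qtwo.1 h
    rw [← mul_add]
    refine IsRounding.I_pow_mul ⟨m, l, rfl, ?_, ?_⟩ k
    · rw [cu_add, cu_basis, cu_int]
      exact .of_pos hm hu.1 hu.2
    · rw [cv_add, cv_basis, cv_int]
      exact .of_pos hl hv.1 hv.2

theorem exists_rotation_to_quadrant (m l : ℤ) (h : m ≠ 0 ∨ l ≠ 0) :
    ∃ (k : Fin 4) (m' l' : ℤ), 0 < m' ∧ 0 ≤ l' ∧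
      (m * (1 + I) + l * (1 - I) : ℂ) = I ^ (k : ℕ) * (m' * (1 + I) + l' * (1 - I)) := by
  by_cases h1 : 0 < m ∧ 0 ≤ l
  · exact ⟨0, m, l, h1.1, h1.2, by simp⟩
  by_cases h2 : 0 < -l ∧ 0 ≤ m
  · refine ⟨1, -l, m, h2.1, h2.2, ?_⟩
    simp
    linear_combination (l + m : ℂ) * I_mul_I
  by_cases h3 : 0 < -m ∧ 0 ≤ -l
  · exact ⟨2, -m, -l, h3.1, h3.2, by simp; ring⟩
  · refine ⟨3, l, -m, by omega, by omega, ?_⟩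
    simp [I_pow_three]
    linear_combination (l + m : ℂ) * I_mul_I

theorem mem_Q_of_isRounding {z w : ℂ} (h : IsRounding z w) : z ∈ Q w := by
  obtain ⟨m, l, rfl, hm, hl⟩ := h
  by_cases h0 : m = 0 ∧ l = 0
  · obtain ⟨rfl, rfl⟩ := h0
    refine Or.inl ⟨by simp, mem_closure_X.2 ?_⟩
    have h1 := hm.lower
    have h2 := hm.upper
    have h3 := hl.lower
    have h4 := hl.upper
    norm_num at h1 h2 h3 h4 ⊢
    exact ⟨⟨h1, h2⟩, h3, h4⟩
  obtain ⟨k, m', l', hm', hl', he⟩ := exists_rotation_to_quadrant m l (by tauto)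
  have hr : IsRounding z (I ^ (k : ℕ) * (m' * (1 + I) + l' * (1 - I))) := ⟨m, l, he.symm, hm, hl⟩
  have hk : I ^ (4 - (k : ℕ)) * I ^ (k : ℕ) = 1 := by
    rw [← pow_add, Nat.sub_add_cancel k.2.le, I_pow_four]
  have hk' (y : ℂ) : I ^ (k : ℕ) * (I ^ (4 - (k : ℕ)) * y) = y := by
    rw [← mul_assoc, mul_comm (I ^ (k : ℕ)), hk, one_mul]
  -- Undoing the rotation moves w to the quadrant m' > 0, l' ≥ 0, where l' decides between `Ltwo`
  -- and `Ldiag`.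
  obtain ⟨a, b, hab, ha, hb⟩ := hr.I_pow_mul (4 - (k : ℕ))
  rw [← mul_assoc, hk, one_mul] at hab
  have ea : a = m' := by
    have := congrArg cu hab
    rw [cu_int, cu_int] at this
    exact_mod_cast this.symm
  have eb : b = l' := by
    have := congrArg cv hab
    rw [cv_int, cv_int] at this
    exact_mod_cast this.symm
  subst ea eb
  set y := I ^ (4 - (k : ℕ)) * z
  have hz : z = I ^ (k : ℕ) * (((cu y - a : ℝ) : ℂ) * (1 + I) + ((cv y - b : ℝ) : ℂ) * (1 - I))
      + I ^ (k : ℕ) * (a * (1 + I) + b * (1 - I)) := by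
    rw [← mul_add]
    conv_lhs => rw [← hk' z, eq_of_coords (I ^ (4 - (k : ℕ)) * z)]
    push_cast; ring
  rw [he]
  have hu : -1 / 2 < cu y - a ∧ cu y - a ≤ 1 / 2 := ⟨ha.lt_of_pos hm', by linarith [ha.upper]⟩
  rcases hl'.lt_or_eq with hb0 | rfl
  · exact Or.inr (Or.inr ⟨k, ⟨a, b, hm', hb0, rfl⟩,
      mem_Qtwo.2 ⟨_, _, hu, ⟨hb.lt_of_pos hb0, by linarith [hb.upper]⟩, hz⟩⟩)
  · refine Or.inr (Or.inl ⟨k, ⟨a, hm', by push_cast; ring⟩,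
      mem_Qdiag.2 ⟨_, _, hu, ⟨by linarith [hb.lower], by linarith [hb.upper]⟩, hz⟩⟩)

theorem exists_mem_Q (z : ℂ) : ∃ w, w ∈ lattice ∧ z ∈ Q w := by
  obtain ⟨m, hm⟩ := exists_nearestInt (cu z)
  obtain ⟨l, hl⟩ := exists_nearestInt (cv z)
  exact ⟨_, mem_lattice.2 ⟨m, l, rfl⟩, mem_Q_of_isRounding ⟨m, l, rfl, hm, hl⟩⟩

theorem floorH_of_mem {z : ℂ} (h : z ∈ gaussInt) : floorH z = z := if_pos h

/-- Off the Gaussian integers, `floorH` rounds both coordinates. -/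
theorem isRounding_floorH {z : ℂ} (h : z ∉ gaussInt) : IsRounding z (floorH z) := by
  rw [floorH, if_neg h, dif_pos (exists_mem_Q z)]
  exact isRounding_of_mem_Q (exists_mem_Q z).choose_spec.2

theorem IsRounding.sub_mem_closure_X {z w : ℂ} (h : IsRounding z w) : z - w ∈ closure X := by
  obtain ⟨m, l, rfl, hm, hl⟩ := h
  rw [mem_closure_X, cu_sub, cv_sub, cu_int, cv_int]
  exact ⟨⟨by linarith [hm.lower], by linarith [hm.upper]⟩, by linarith [hl.lower],
    by linarith [hl.upper]⟩

theorem IsRounding.mem_gaussInt {z w : ℂ} (h : IsRounding z w) : w ∈ gaussInt := by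
  obtain ⟨m, l, rfl, -, -⟩ := h
  exact lattice_subset_gaussInt (mem_lattice.2 ⟨m, l, rfl⟩)

/-! ### The dual domain and its behaviour under the natural extension. -/

theorem sq_add_sq_eq_one {a b : ℤ} (h : a ^ 2 + b ^ 2 = 1) :
    a = 1 ∧ b = 0 ∨ a = -1 ∧ b = 0 ∨ a = 0 ∧ b = 1 ∨ a = 0 ∧ b = -1 := by
  have ha : -1 ≤ a ∧ a ≤ 1 :=
    abs_le.1 (abs_le_one_iff_mul_self_le_one.2 (by nlinarith [sq_nonneg b]))
  have hb : -1 ≤ b ∧ b ≤ 1 :=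
    abs_le.1 (abs_le_one_iff_mul_self_le_one.2 (by nlinarith [sq_nonneg a]))
  obtain ⟨h1, h2⟩ := ha
  obtain ⟨h3, h4⟩ := hb
  interval_cases a <;> interval_cases b <;> simp_all

theorem NearestInt.eq_zero_of_pos {t : ℝ} {m : ℤ} (h : NearestInt t m) (ht : t = 1 / 2) :
    m = 0 := by
  subst ht
  have h1 : m ≤ 1 := by exact_mod_cast (by linarith [h.lower] : (m : ℝ) ≤ 1)
  have h2 : 0 ≤ m := by exact_mod_cast (by linarith [h.upper] : (0 : ℝ) ≤ m)
  rcases (by omega : m = 0 ∨ m = 1) with rfl | rfl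
  · rfl
  · exact absurd (h.lower_tie (by norm_num)) (by norm_num)

theorem NearestInt.eq_zero_of_neg {t : ℝ} {m : ℤ} (h : NearestInt t m) (ht : t = -(1 / 2)) :
    m = 0 := by
  have := h.neg.eq_zero_of_pos (by rw [ht, neg_neg])
  omega

/-- The fibre condition of the (closed) natural extension domain: `z'` is not inside the unit
circle, nor inside the unit circle around `d` whenever `z` is inside the circle with
diameter from `0` to `d`, for `d = ±1 ± i`. -/
structure InDual (z z' : ℂ) : Prop where
  one_le : 1 / 2 ≤ cu z' ^ 2 + cv z' ^ 2
  of_disc : ∀ a b : ℤ, a ^ 2 + b ^ 2 = 1 → cu z ^ 2 + cv z ^ 2 < a * cu z + b * cv z →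
    1 / 2 ≤ (cu z' - a) ^ 2 + (cv z' - b) ^ 2

/-- The closed square meets the unit circle only at its vertices ±1, ±i, which are Gaussian
integers. -/
theorem sq_lt_half_of_irrational {z : ℂ} (hz : z ∈ closure X) (hq : z ∉ gaussInt) :
    cu z ^ 2 + cv z ^ 2 < 1 / 2 := by
  obtain ⟨⟨h1, h2⟩, h3, h4⟩ := mem_closure_X.1 hz
  refine lt_of_le_of_ne (by nlinarith) fun h => hq ?_
  have e1 : (cu z + 1 / 2) * (cu z - 1 / 2) = 0 := by nlinarith
  have e2 : (cv z + 1 / 2) * (cv z - 1 / 2) = 0 := by nlinarith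
  rw [eq_of_coords z]
  rcases mul_eq_zero.1 e1 with e1 | e1 <;> rcases mul_eq_zero.1 e2 with e2 | e2
  · rw [show cu z = -1 / 2 by linarith, show cv z = -1 / 2 by linarith]
    exact ⟨-1, 0, by push_cast; ring⟩
  · rw [show cu z = -1 / 2 by linarith, show cv z = 1 / 2 by linarith]
    exact ⟨0, -1, by push_cast; ring⟩
  · rw [show cu z = 1 / 2 by linarith, show cv z = -1 / 2 by linarith]
    exact ⟨0, 1, by push_cast; ring⟩
  · rw [show cu z = 1 / 2 by linarith, show cv z = 1 / 2 by linarith]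
    exact ⟨1, 0, by push_cast; ring⟩

section Inversion

variable {z : ℂ}

theorem coords_sq_pos (hz : z ≠ 0) : 0 < cu z ^ 2 + cv z ^ 2 := by
  have := norm_sq_eq z
  have h : 0 < ‖z‖ ^ 2 := by positivity
  linarith

theorem inv_coords_sq (hz : z ≠ 0) :
    cu (1 / z) ^ 2 + cv (1 / z) ^ 2 = 1 / (4 * (cu z ^ 2 + cv z ^ 2)) := by
  have := coords_sq_pos hz
  rw [cu_inv, cv_inv]
  field_simp
  ring

/-- A circle through 0 inverts to a line: the disc with diameter [0, d] becomes the half-plane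
beyond an edge line of the square. -/
theorem half_lt_inv (hz : z ≠ 0) (a b : ℝ) :
    1 / 2 < a * cu (1 / z) + b * cv (1 / z) ↔ cu z ^ 2 + cv z ^ 2 < b * cu z + a * cv z := by
  have := coords_sq_pos hz
  rw [cu_inv, cv_inv, ← sub_pos, ← sub_pos (b := cu z ^ 2 + cv z ^ 2)]
  have : a * (cv z / (2 * (cu z ^ 2 + cv z ^ 2))) + b * (cu z / (2 * (cu z ^ 2 + cv z ^ 2))) - 1 / 2
      = (b * cu z + a * cv z - (cu z ^ 2 + cv z ^ 2)) / (2 * (cu z ^ 2 + cv z ^ 2)) := by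
    field_simp; ring
  rw [this, div_pos_iff_of_pos_right (by positivity)]

/-- The same inversion read backwards: the edges of the square become circles with diameter [0, d].
-/
theorem inv_outside (hz : z ≠ 0) (hX : z ∈ closure X) (a b : ℤ) (hab : a ^ 2 + b ^ 2 = 1) :
    a * cu (1 / z) + b * cv (1 / z) ≤ cu (1 / z) ^ 2 + cv (1 / z) ^ 2 := by
  have h0 := coords_sq_pos hz
  obtain ⟨⟨h1, h2⟩, h3, h4⟩ := mem_closure_X.1 hX
  rw [inv_coords_sq hz, cu_inv, cv_inv, ← sub_nonneg]
  have : 1 / (4 * (cu z ^ 2 + cv z ^ 2)) - (a * (cv z / (2 * (cu z ^ 2 + cv z ^ 2))) +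
      b * (cu z / (2 * (cu z ^ 2 + cv z ^ 2)))) =
      (1 / 2 - (a * cv z + b * cu z)) / (2 * (cu z ^ 2 + cv z ^ 2)) := by
    field_simp; ring
  rw [this]
  refine div_nonneg ?_ (by positivity)
  rcases sq_add_sq_eq_one hab with ⟨rfl, rfl⟩ | ⟨rfl, rfl⟩ | ⟨rfl, rfl⟩ | ⟨rfl, rfl⟩ <;>
    push_cast <;> linarith

/-- Since |d|² = 2 = 1 + 1, the unit circle around d is orthogonal to the unit circle, so inversion
maps it to its complex conjugate and keeps exteriors exterior. -/
theorem half_le_inv_sub (hz : z ≠ 0) (a b : ℝ) (hab : a ^ 2 + b ^ 2 = 1) :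
    1 / 2 ≤ (cu (1 / z) - a) ^ 2 + (cv (1 / z) - b) ^ 2 ↔
      1 / 2 ≤ (cu z - b) ^ 2 + (cv z - a) ^ 2 := by
  have h0 := coords_sq_pos hz
  rw [← sub_nonneg, ← sub_nonneg (a := (cu z - b) ^ 2 + (cv z - a) ^ 2)]
  have h1 := inv_coords_sq hz
  have : (cu (1 / z) - a) ^ 2 + (cv (1 / z) - b) ^ 2 - 1 / 2 =
      ((cu z - b) ^ 2 + (cv z - a) ^ 2 - 1 / 2) / (2 * (cu z ^ 2 + cv z ^ 2)) := by
    rw [eq_div_iff (by positivity)]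
    have e : (cu (1 / z) - a) ^ 2 + (cv (1 / z) - b) ^ 2 - 1 / 2 =
      1 / (4 * (cu z ^ 2 + cv z ^ 2)) - 2 * (a * cu (1 / z) + b * cv (1 / z)) + 1 / 2 := by
      rw [← h1]; linear_combination hab
    rw [e, cu_inv, cv_inv]
    field_simp
    linear_combination (-8) * hab
  rw [this, le_div_iff₀ (by positivity), zero_mul]

end Inversion

/-- The inverse of a point of norm at least one has norm at most one. -/
theorem inv_sq_le {z : ℂ} (h : 1 / 2 ≤ cu z ^ 2 + cv z ^ 2) :
    cu (1 / z) ^ 2 + cv (1 / z) ^ 2 ≤ 1 / 2 := by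
  have hz : z ≠ 0 := by rintro rfl; norm_num [cu, cv] at h
  rw [inv_coords_sq hz, div_le_iff₀ (by linarith)]
  linarith

theorem inv_sq_lt {z : ℂ} (h : 1 / 2 < cu z ^ 2 + cv z ^ 2) :
    cu (1 / z) ^ 2 + cv (1 / z) ^ 2 < 1 / 2 := by
  have hz : z ≠ 0 := by rintro rfl; norm_num [cu, cv] at h
  rw [inv_coords_sq hz, div_lt_iff₀ (by linarith)]
  linarith

theorem half_lt_inv_sq {z : ℂ} (hz : z ≠ 0) (h : cu z ^ 2 + cv z ^ 2 < 1 / 2) :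
    1 / 2 < cu (1 / z) ^ 2 + cv (1 / z) ^ 2 := by
  have := coords_sq_pos hz
  rw [inv_coords_sq hz, lt_div_iff₀ (by linarith)]
  linarith

theorem half_le_of_two_le {y₁ y₂ : ℝ} {m l : ℤ} (hy : y₁ ^ 2 + y₂ ^ 2 ≤ 1 / 2)
    (h : 2 ≤ m ^ 2 + l ^ 2) : 1 / 2 ≤ (y₁ - m) ^ 2 + (y₂ - l) ^ 2 := by
  have h' : (2 : ℝ) ≤ (m : ℝ) ^ 2 + (l : ℝ) ^ 2 := by exact_mod_cast h
  nlinarith [sq_nonneg (2 * y₁ - m), sq_nonneg (2 * y₂ - l)]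

theorem int_sq_cases (m l : ℤ) : (m = 0 ∧ l = 0) ∨ m ^ 2 + l ^ 2 = 1 ∨ 2 ≤ m ^ 2 + l ^ 2 := by
  by_cases h : m = 0 ∧ l = 0
  · exact Or.inl h
  · right
    have : 0 < m ^ 2 + l ^ 2 := by
      rcases not_and_or.1 h with h | h <;> positivity
    omega

/-- The geometric core of the invariance of the natural extension domain. -/
theorem dual_step {x₁ x₂ y₁ y₂ : ℝ} {m l : ℤ} (hx : 1 / 2 < x₁ ^ 2 + x₂ ^ 2)
    (hout : ∀ a b : ℤ, a ^ 2 + b ^ 2 = 1 → a * x₁ + b * x₂ ≤ x₁ ^ 2 + x₂ ^ 2)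
    (hm1 : (m : ℝ) - 1 / 2 ≤ x₁) (hm2 : x₁ ≤ m + 1 / 2)
    (hl1 : (l : ℝ) - 1 / 2 ≤ x₂) (hl2 : x₂ ≤ l + 1 / 2)
    (hy : y₁ ^ 2 + y₂ ^ 2 ≤ 1 / 2)
    (hxy : ∀ a b : ℤ, a ^ 2 + b ^ 2 = 1 → 1 / 2 < a * x₁ + b * x₂ →
      1 / 2 ≤ (y₁ - a) ^ 2 + (y₂ - b) ^ 2) :
    1 / 2 ≤ (y₁ - m) ^ 2 + (y₂ - l) ^ 2 ∧
      ∀ a b : ℤ, a ^ 2 + b ^ 2 = 1 →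
        (x₁ - m) ^ 2 + (x₂ - l) ^ 2 < a * (x₁ - m) + b * (x₂ - l) →
        1 / 2 ≤ (y₁ - m - a) ^ 2 + (y₂ - l - b) ^ 2 := by
  constructor
  -- Here x = 1/z and y = 1/z'. The digit is not 0 as |x| > 1; a digit of norm √2 puts x beyond the
  -- matching edge line, so `hxy` applies; a digit of norm at least 2 is far from the unit disc
  -- containing y.
  · rcases int_sq_cases m l with ⟨rfl, rfl⟩ | h | h
    · norm_num at hm1 hm2 hl1 hl2
      nlinarith
    · refine hxy m l h ?_
      rcases sq_add_sq_eq_one h with ⟨rfl, rfl⟩ | ⟨rfl, rfl⟩ | ⟨rfl, rfl⟩ | ⟨rfl, rfl⟩ <;>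
        push_cast at * <;> by_contra! hc <;> nlinarith
    · exact half_le_of_two_le hy h
  · intro a b hab hd
    have key : 1 / 2 ≤ (y₁ - (m + a : ℤ)) ^ 2 + (y₂ - (l + b : ℤ)) ^ 2 := by
      -- The same trichotomy for the shifted centre w + d. If w + d = 0, then x would lie in the
      -- open disc with diameter [0, w], against `hout`.
      rcases int_sq_cases (m + a) (l + b) with ⟨h1, h2⟩ | h | h
      · obtain rfl : m = -a := by omega
        obtain rfl : l = -b := by omega
        have := hout (-a) (-b) (by linarith)
        have hab' : (a : ℝ) ^ 2 + (b : ℝ) ^ 2 = 1 := by exact_mod_cast hab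
        push_cast at this hd
        nlinarith
      · refine hxy _ _ h ?_
        rcases sq_add_sq_eq_one hab with ⟨rfl, rfl⟩ | ⟨rfl, rfl⟩ | ⟨rfl, rfl⟩ | ⟨rfl, rfl⟩ <;>
        rcases sq_add_sq_eq_one h with ⟨h1, h2⟩ | ⟨h1, h2⟩ | ⟨h1, h2⟩ | ⟨h1, h2⟩ <;>
        rw [h1, h2] <;>
        obtain rfl := eq_sub_of_add_eq h1 <;> obtain rfl := eq_sub_of_add_eq h2 <;>
        clear hxy hout <;> norm_num at * <;> by_contra! hc <;> nlinarith
      · exact half_le_of_two_le hy h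
    push_cast at key
    convert key using 2 <;> ring

/-- The natural extension maps the closed domain into itself. -/
theorem InDual.map {z z' : ℂ} (h : InDual z z') (hX : z ∈ closure X) (hz : z ≠ 0)
    (hz1 : cu z ^ 2 + cv z ^ 2 < 1 / 2) {w : ℂ} (hw : IsRounding (1 / z) w) :
    InDual (1 / z - w) (1 / z' - w) := by
  have hz' : z' ≠ 0 := by
    rintro rfl
    have := h.one_le
    norm_num [cu, cv] at this
  obtain ⟨m, l, rfl, hm, hl⟩ := hw
  have key := dual_step (half_lt_inv_sq hz hz1) (inv_outside hz hX) hm.lower hm.upper hl.lower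
    hl.upper (inv_sq_le h.one_le) (fun a b hab hd => ?_)
  · constructor
    · simpa only [cu_sub, cv_sub, cu_int, cv_int] using key.1
    · simpa only [cu_sub, cv_sub, cu_int, cv_int] using key.2
  · rw [half_le_inv_sub hz' a b (by exact_mod_cast hab)]
    exact h.of_disc b a (by rwa [add_comm]) ((half_lt_inv hz a b).1 hd)

/-- The natural extension is injective. -/
theorem InDual.rounding_unique {z₁ z₁' z₂ z₂' w₁ w₂ : ℂ} (h₁ : InDual z₁ z₁') (h₂ : InDual z₂ z₂')
    (hz₁ : z₁ ≠ 0) (hz₂ : z₂ ≠ 0)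
    (hs₁ : 1 / 2 < cu z₁' ^ 2 + cv z₁' ^ 2) (hs₂ : 1 / 2 < cu z₂' ^ 2 + cv z₂' ^ 2)
    (hw₁ : IsRounding (1 / z₁) w₁) (hw₂ : IsRounding (1 / z₂) w₂)
    (he : 1 / z₁ - w₁ = 1 / z₂ - w₂) (he' : 1 / z₁' - w₁ = 1 / z₂' - w₂) : w₁ = w₂ := by
  -- Contrapositive of the fibre condition after inversion: if 1/z' is within distance 1 of d, then
  -- 1/z is not beyond the edge line facing d.
  have aux {z z' : ℂ} (h : InDual z z') (hz : z ≠ 0) (hs : 1 / 2 < cu z' ^ 2 + cv z' ^ 2)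
      (a b : ℤ) (hab : a ^ 2 + b ^ 2 = 1)
      (hlt : (cu (1 / z') - a) ^ 2 + (cv (1 / z') - b) ^ 2 < 1 / 2) :
      a * cu (1 / z) + b * cv (1 / z) ≤ 1 / 2 := by
    have hz' : z' ≠ 0 := by rintro rfl; norm_num [cu, cv] at hs
    by_contra! hc
    rw [half_lt_inv hz] at hc
    have := h.of_disc b a (by rwa [add_comm]) hc
    rw [← half_le_inv_sub hz' a b (by exact_mod_cast hab)] at this
    linarith
  have a₁ := aux h₁ hz₁ hs₁
  have a₂ := aux h₂ hz₂ hs₂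
  have n₁ := inv_sq_lt hs₁
  have n₂ := inv_sq_lt hs₂
  obtain ⟨m₁, l₁, rfl, hm₁, hl₁⟩ := hw₁
  obtain ⟨m₂, l₂, rfl, hm₂, hl₂⟩ := hw₂
  have eu := congrArg cu he
  have ev := congrArg cv he
  have eu' := congrArg cu he'
  have ev' := congrArg cv he'
  simp only [cu_sub, cv_sub, cu_int, cv_int] at eu ev eu' ev'
  have hu : cu (1 / z₂') = cu (1 / z₁') + ((m₂ - m₁ : ℤ) : ℝ) := by push_cast; linarith
  have hv : cv (1 / z₂') = cv (1 / z₁') + ((l₂ - l₁ : ℤ) : ℝ) := by push_cast; linarith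
  rcases int_sq_cases (m₂ - m₁) (l₂ - l₁) with ⟨h1, h2⟩ | h | h
  · rw [show m₁ = m₂ by omega, show l₁ = l₂ by omega]
  · exfalso
    have b₂ := a₂ _ _ h (by rw [hu, hv]; simpa using n₁)
    have b₁ := a₁ (-(m₂ - m₁)) (-(l₂ - l₁)) (by linarith) (by
      rw [hu, hv] at n₂; push_cast at n₂ ⊢; simpa [sub_eq_add_neg] using n₂)
    -- The two bounds put the inverses on opposite edges of the central square, with coordinates
    -- -1/2 and 1/2. The tie rule sends both to 0, although the digits were to differ by 1.
    rcases sq_add_sq_eq_one h with ⟨h1, h2⟩ | ⟨h1, h2⟩ | ⟨h1, h2⟩ | ⟨h1, h2⟩ <;>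
      rw [h1, h2] at b₁ b₂ <;> push_cast at b₁ b₂ <;>
      have h1' := congrArg (Int.cast : ℤ → ℝ) h1 <;> have h2' := congrArg (Int.cast : ℤ → ℝ) h2 <;>
      push_cast at h1' h2'
    · have := hm₁.eq_zero_of_neg (by linarith)
      have := hm₂.eq_zero_of_pos (by linarith)
      omega
    · have := hm₁.eq_zero_of_pos (by linarith)
      have := hm₂.eq_zero_of_neg (by linarith)
      omega
    · have := hl₁.eq_zero_of_neg (by linarith)
      have := hl₂.eq_zero_of_pos (by linarith)
      omega
    · have := hl₁.eq_zero_of_pos (by linarith)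
      have := hl₂.eq_zero_of_neg (by linarith)
      omega
  · exfalso
    -- Two points of the open unit disc cannot be at distance 2 or more.
    have := half_le_of_two_le (m := -(m₂ - m₁)) (l := -(l₂ - l₁)) n₁.le (by linarith)
    push_cast at this hu hv
    rw [hu, hv] at n₂
    nlinarith

/-! ### The regions of N₁ as inequalities in the coordinates. -/

/-- The coordinates of `i^k(1-i)` in the basis `1 + i, 1 - i`. -/
def dir : ℕ → ℤ × ℤ
  | 0 => (0, 1)
  | k + 1 => ((dir k).2, -(dir k).1)

theorem I_pow_mul_eq (k : ℕ) : I ^ k * (1 - I) = (dir k).1 * (1 + I) + (dir k).2 * (1 - I) := by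
  induction k with
  | zero => simp [dir]
  | succ k ih =>
    rw [pow_succ', mul_assoc, ih]
    simp only [dir]
    push_cast
    linear_combination ((dir k).1 - (dir k).2 : ℂ) * I_mul_I

theorem dir_sq (k : ℕ) : (dir k).1 ^ 2 + (dir k).2 ^ 2 = 1 := by
  induction k with
  | zero => simp [dir]
  | succ k ih => simp only [dir]; linarith

/-- Half the inner product of `z` with `i^k(1-i)`. -/
def dirDot (k : ℕ) (z : ℂ) : ℝ := (dir k).1 * cu z + (dir k).2 * cv z

/-- Half the square of the absolute value. -/
def halfSq (z : ℂ) : ℝ := cu z ^ 2 + cv z ^ 2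

theorem norm_sq_eq_halfSq (z : ℂ) : ‖z‖ ^ 2 = 2 * halfSq z := norm_sq_eq z

theorem one_le_norm_iff {z : ℂ} : 1 ≤ ‖z‖ ↔ 1 / 2 ≤ halfSq z := by
  rw [← one_le_sq_iff₀ (norm_nonneg z), norm_sq_eq_halfSq]
  constructor <;> intro <;> linarith

theorem one_lt_norm_iff {z : ℂ} : 1 < ‖z‖ ↔ 1 / 2 < halfSq z := by
  rw [← one_lt_sq_iff₀ (norm_nonneg z), norm_sq_eq_halfSq]
  constructor <;> intro <;> linarith

theorem norm_le_one_iff {z : ℂ} : ‖z‖ ≤ 1 ↔ halfSq z ≤ 1 / 2 := by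
  rw [← not_lt, one_lt_norm_iff, not_lt]

theorem norm_sub_half_dir_sq (k : ℕ) (z : ℂ) :
    ‖z - I ^ k * (1 - I) / 2‖ ^ 2 = 2 * (halfSq z - dirDot k z) + 1 / 2 := by
  have h : ((dir k).1 : ℝ) ^ 2 + ((dir k).2 : ℝ) ^ 2 = 1 := by exact_mod_cast dir_sq k
  rw [I_pow_mul_eq, norm_sq_eq, cu_sub, cv_sub,
    show ((dir k).1 * (1 + I) + (dir k).2 * (1 - I) : ℂ) / 2 =
      (((dir k).1 / 2 : ℝ) : ℂ) * (1 + I) + (((dir k).2 / 2 : ℝ) : ℂ) * (1 - I) by push_cast; ring,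
    cu_basis, cv_basis, halfSq, dirDot]
  linear_combination (1 / 2 : ℝ) * h

theorem sqrt_two_half_sq : (√2 / 2) ^ 2 = (1 / 2 : ℝ) := by
  rw [div_pow, Real.sq_sqrt (by norm_num)]; norm_num

theorem norm_sub_half_dir_lt {k : ℕ} {z : ℂ} :
    ‖z - I ^ k * (1 - I) / 2‖ < √2 / 2 ↔ halfSq z < dirDot k z := by
  rw [← sq_lt_sq₀ (norm_nonneg _) (by positivity), norm_sub_half_dir_sq, sqrt_two_half_sq]
  constructor <;> intro <;> linarith

theorem lt_norm_sub_half_dir {k : ℕ} {z : ℂ} :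
    √2 / 2 < ‖z - I ^ k * (1 - I) / 2‖ ↔ dirDot k z < halfSq z := by
  rw [← sq_lt_sq₀ (by positivity) (norm_nonneg _), norm_sub_half_dir_sq, sqrt_two_half_sq]
  constructor <;> intro <;> linarith

theorem norm_sub_half_dir_eq {k : ℕ} {z : ℂ} :
    ‖z - I ^ k * (1 - I) / 2‖ = √2 / 2 ↔ halfSq z = dirDot k z := by
  rw [← sq_eq_sq₀ (norm_nonneg _) (by positivity), norm_sub_half_dir_sq, sqrt_two_half_sq]
  constructor <;> intro <;> linarith

theorem one_le_norm_sub_dir {k : ℕ} {z : ℂ} : 1 ≤ ‖z - I ^ k * (1 - I)‖ ↔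
    1 / 2 ≤ (cu z - (dir k).1) ^ 2 + (cv z - (dir k).2) ^ 2 := by
  rw [one_le_norm_iff, I_pow_mul_eq, halfSq, cu_sub, cv_sub, cu_int, cv_int]

theorem mem_XA {j : Fin 4} {z : ℂ} :
    z ∈ XA j ↔ z ∈ X ∧ ∀ k ≤ 2, dirDot (k + j + 1) z < halfSq z := by
  -- As 1+i = i(1-i), the index shifts by one: `XA j` excludes the discs in directions j+1, j+2, j+3
  -- and leaves only direction j.
  have (n : ℕ) : I ^ n * (1 + I) / 2 = I ^ (n + 1) * (1 - I) / 2 := by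
    rw [pow_succ]; linear_combination (I ^ n / 2 : ℂ) * I_mul_I
  simp only [XA, this, gt_iff_lt, lt_norm_sub_half_dir]; rfl

theorem mem_XB {j : Fin 4} {z : ℂ} :
    z ∈ XB j ↔ z ∈ X ∧ ∀ k ≤ 1, halfSq z < dirDot (k + j) z := by
  simp only [XB, norm_sub_half_dir_lt]; rfl

theorem mem_WA {j : Fin 4} {z : ℂ} : z ∈ WA j ↔ 1 / 2 < halfSq z ∧
    1 / 2 ≤ (cu z - (dir j).1) ^ 2 + (cv z - (dir j).2) ^ 2 := by
  simp only [WA, gt_iff_lt, ge_iff_le, one_lt_norm_iff, one_le_norm_sub_dir]; rfl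

theorem mem_WB {j : Fin 4} {z : ℂ} : z ∈ WB j ↔ 1 / 2 < halfSq z ∧
    ∀ k ≤ 1, 1 / 2 ≤ (cu z - (dir (k + j)).1) ^ 2 + (cv z - (dir (k + j)).2) ^ 2 := by
  simp only [WB, gt_iff_lt, ge_iff_le, one_lt_norm_iff, one_le_norm_sub_dir]; rfl

theorem mem_K {j : Fin 4} {z : ℂ} : z ∈ K j ↔ halfSq z = dirDot j z ∧ halfSq z ≤ 1 / 2 := by
  have : I ^ (j : ℕ) * (1 / 2 - 1 / 2 * I) = I ^ (j : ℕ) * (1 - I) / 2 := by ring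
  simp only [K, this, norm_sub_half_dir_eq, norm_le_one_iff]; rfl

theorem mem_K' {j : Fin 4} {z : ℂ} : z ∈ K' j ↔ halfSq z = dirDot j z ∧ 1 / 2 < halfSq z := by
  have : I ^ (j : ℕ) * (1 / 2 - 1 / 2 * I) = I ^ (j : ℕ) * (1 - I) / 2 := by ring
  simp only [K', this, norm_sub_half_dir_eq, gt_iff_lt, one_lt_norm_iff]; rfl

theorem halfSq_I_pow_mul (k : ℕ) (z : ℂ) : halfSq (I ^ k * z) = halfSq z := by
  have h1 := norm_sq_eq_halfSq (I ^ k * z)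
  have h2 := norm_sq_eq_halfSq z
  rw [norm_mul, norm_pow, norm_I, one_pow, one_mul] at h1
  linarith

theorem dirDot_I_pow_mul (k : ℕ) (z : ℂ) : dirDot k (I ^ k * z) = cv z := by
  induction k with
  | zero => simp [dirDot, dir]
  | succ k ih =>
    rw [← ih, pow_succ', mul_assoc]
    simp only [dirDot, dir, cu_I_mul, cv_I_mul]
    push_cast; ring

theorem exists_edge_param {j : ℕ} {z : ℂ} (h : dirDot j z = 1 / 2) :
    ∃ s t : ℝ, s + t = 1 ∧ z = I ^ j * (s - I * t) ∧ halfSq z = (s - 1 / 2) ^ 2 + 1 / 4 := by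
  obtain ⟨y, hy⟩ := exists_rotation j z 0
  rw [add_zero] at hy
  subst hy
  rw [dirDot_I_pow_mul] at h
  refine ⟨cu y + 1 / 2, 1 / 2 - cu y, by ring, ?_, ?_⟩
  · rw [eq_of_coords y, cu_basis, h]; push_cast; ring
  · rw [halfSq_I_pow_mul, halfSq, h]; ring

theorem edge_param (j : ℕ) {s t : ℝ} (h : s + t = 1) : dirDot j (I ^ j * (s - I * t)) = 1 / 2 ∧
    halfSq (I ^ j * (s - I * t)) = (s - 1 / 2) ^ 2 + 1 / 4 := by
  obtain rfl : t = 1 - s := by linarith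
  rw [dirDot_I_pow_mul, halfSq_I_pow_mul, halfSq]
  simp [cu, cv]; ring

theorem mem_Y {j : Fin 4} {z : ℂ} : z ∈ Y j ↔ dirDot j z = 1 / 2 ∧ halfSq z ≤ 1 / 2 := by
  constructor
  · rintro ⟨s, t, h, h0, h1, rfl⟩
    refine ⟨(edge_param j h).1, ?_⟩
    rw [(edge_param j h).2]; nlinarith
  · rintro ⟨h, h'⟩
    obtain ⟨s, t, hst, hz, hs⟩ := exists_edge_param h
    exact ⟨s, t, hst, by nlinarith, by nlinarith, hz⟩

theorem mem_Y' {j : Fin 4} {z : ℂ} : z ∈ Y' j ↔ dirDot j z = 1 / 2 ∧ 1 / 2 ≤ halfSq z := by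
  constructor
  · rintro ⟨s, t, h, h0, rfl⟩
    refine ⟨(edge_param j h).1, ?_⟩
    rw [(edge_param j h).2]
    rcases h0 with h0 | h0 <;> nlinarith
  · rintro ⟨h, h'⟩
    obtain ⟨s, t, hst, hz, hs⟩ := exists_edge_param h
    refine ⟨s, t, hst, ?_, hz⟩
    by_contra! hc
    nlinarith

/-! ### Passing from z to its conjugate on the boundary curves. -/

section Reflection

variable {z z' : ℂ}

/-- The unit circle has coefficients in ℚ(i), so `ConjPair.reflect` applies. It makes |z'| > 1
strict when |z| < 1 and |z'| ≥ 1. -/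
theorem ConjPair.halfSq_eq_half (h : ConjPair z z') (h0 : halfSq z = 1 / 2) :
    halfSq z' = 1 / 2 := by
  have e (y : ℂ) : 1 * (y * conj y) + 0 * y + conj (0 : ℂ) * conj y + (-1) =
      ((2 * halfSq y - 1 : ℝ) : ℂ) := by
    rw [mul_conj, ← norm_sq_eq_halfSq, Complex.normSq_eq_norm_sq]; simp; ring
  have := h.reflect (one_mem Qi) (zero_mem Qi) (neg_mem (one_mem Qi)) (by simp)
    (by rw [e, h0]; norm_num)
  rw [e, Complex.ofReal_eq_zero] at this
  linarith

theorem dir_mem_Qi (k : ℕ) : I ^ k * (1 - I) ∈ Qi :=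
  mul_mem (pow_mem I_mem_Qi k) (sub_mem (one_mem _) I_mem_Qi)

theorem dir_mul_conj (k : ℕ) : I ^ k * (1 - I) * conj (I ^ k * (1 - I)) = 2 := by
  rw [mul_conj, Complex.normSq_eq_norm_sq, norm_sq_eq, I_pow_mul_eq, cu_int, cv_int]
  have h : ((dir k).1 : ℝ) ^ 2 + ((dir k).2 : ℝ) ^ 2 = 1 := by exact_mod_cast dir_sq k
  rw [h]; norm_num

theorem dirDot_eq (k : ℕ) (z : ℂ) :
    conj (I ^ k * (1 - I)) * z + I ^ k * (1 - I) * conj z = ((4 * dirDot k z : ℝ) : ℂ) := by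
  rw [I_pow_mul_eq, dirDot]
  apply Complex.ext <;> simp [cu, cv] <;> ring

theorem ConjPair.halfSq_eq_dirDot (h : ConjPair z z') {k : ℕ} (h0 : halfSq z = dirDot k z) :
    halfSq z' = dirDot k z' := by
  have e (y : ℂ) : 2 * (y * conj y) + (-conj (I ^ k * (1 - I))) * y +
      conj (-conj (I ^ k * (1 - I))) * conj y + 0 = ((4 * (halfSq y - dirDot k y) : ℝ) : ℂ) := by
    have h1 := dirDot_eq k y
    rw [mul_conj, Complex.normSq_eq_norm_sq, norm_sq_eq_halfSq, map_neg, Complex.conj_conj]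
    push_cast at h1 ⊢
    linear_combination -h1
  have := h.reflect (ofNat_mem Qi 2) (neg_mem (conj_mem_Qi (dir_mem_Qi k))) (zero_mem Qi)
    (by rw [map_neg, Complex.conj_conj, neg_mul_neg, mul_comm (conj _), dir_mul_conj]; norm_num)
    (by rw [e, h0]; norm_num)
  rw [e, Complex.ofReal_eq_zero] at this
  linarith

theorem ConjPair.dirDot_eq_half (h : ConjPair z z') {k : ℕ} (h0 : dirDot k z = 1 / 2) :
    dirDot k z' = 1 / 2 := by
  have e (y : ℂ) : 0 * (y * conj y) + conj (I ^ k * (1 - I)) * y +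
      conj (conj (I ^ k * (1 - I))) * conj y + (-2) = ((4 * dirDot k y - 2 : ℝ) : ℂ) := by
    have h1 := dirDot_eq k y
    rw [Complex.conj_conj]
    push_cast at h1 ⊢
    linear_combination h1
  have := h.reflect (zero_mem Qi) (conj_mem_Qi (dir_mem_Qi k)) (neg_mem (ofNat_mem Qi 2))
    (by rw [Complex.conj_conj, mul_comm (conj _), dir_mul_conj]; norm_num)
    (by rw [e, h0]; norm_num)
  rw [e, Complex.ofReal_eq_zero] at this
  linarith

end Reflection

/-! ### Comparison of N₁ with the dual domain. -/

theorem exists_dir_eq {a b : ℤ} (h : a ^ 2 + b ^ 2 = 1) : ∃ k : Fin 4, dir k = (a, b) := by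
  rcases sq_add_sq_eq_one h with ⟨rfl, rfl⟩ | ⟨rfl, rfl⟩ | ⟨rfl, rfl⟩ | ⟨rfl, rfl⟩
  exacts [⟨1, rfl⟩, ⟨3, rfl⟩, ⟨0, rfl⟩, ⟨2, rfl⟩]

theorem inDual_iff {z z' : ℂ} : InDual z z' ↔ 1 / 2 ≤ halfSq z' ∧ ∀ k : Fin 4,
    halfSq z < dirDot k z → 1 / 2 ≤ (cu z' - (dir k).1) ^ 2 + (cv z' - (dir k).2) ^ 2 := by
  constructor
  · exact fun h => ⟨h.one_le, fun k hk => h.of_disc _ _ (dir_sq k) hk⟩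
  · refine fun h => ⟨h.1, fun a b hab hd => ?_⟩
    obtain ⟨k, hk⟩ := exists_dir_eq hab
    have := h.2 k
    simp only [dirDot, hk] at this
    exact this hd

theorem dirDot_add_two (k : ℕ) (z : ℂ) : dirDot (k + 2) z = -dirDot k z := by
  simp only [dirDot, dir]; push_cast; ring

theorem dirDot_zero (z : ℂ) : dirDot 0 z = cv z := by simp [dirDot, dir]
theorem dirDot_one (z : ℂ) : dirDot 1 z = cu z := by simp [dirDot, dir]
theorem dirDot_two (z : ℂ) : dirDot 2 z = -cv z := by simp [dirDot, dir]
theorem dirDot_three (z : ℂ) : dirDot 3 z = -cu z := by simp [dirDot, dir]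

theorem dirDot_sq_add (k : ℕ) (z : ℂ) : dirDot k z ^ 2 + dirDot (k + 1) z ^ 2 = halfSq z := by
  have h : ((dir k).1 : ℝ) ^ 2 + ((dir k).2 : ℝ) ^ 2 = 1 := by exact_mod_cast dir_sq k
  simp only [dirDot, dir, halfSq]
  push_cast
  linear_combination (cu z ^ 2 + cv z ^ 2) * h

theorem dist_dir_sq (k : ℕ) (z : ℂ) : (cu z - (dir k).1) ^ 2 + (cv z - (dir k).2) ^ 2 =
    halfSq z - 2 * dirDot k z + 1 := by
  have h : ((dir k).1 : ℝ) ^ 2 + ((dir k).2 : ℝ) ^ 2 = 1 := by exact_mod_cast dir_sq k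
  simp only [dirDot, halfSq]
  linear_combination h

theorem inDual_iff_dirDot {z z' : ℂ} : InDual z z' ↔ 1 / 2 ≤ halfSq z' ∧ ∀ k : Fin 4,
    halfSq z < dirDot k z → 2 * dirDot k z' ≤ halfSq z' + 1 / 2 := by
  rw [inDual_iff]
  simp only [dist_dir_sq]
  refine and_congr_right fun _ => forall_congr' fun k => imp_congr_right fun _ => ?_
  constructor <;> intro <;> linarith

theorem dirDot_le_half {z : ℂ} (h : z ∈ closure X) (k : ℕ) : dirDot k z ≤ 1 / 2 := by
  obtain ⟨⟨h1, h2⟩, h3, h4⟩ := mem_closure_X.1 h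
  rcases sq_add_sq_eq_one (dir_sq k) with ⟨e1, e2⟩ | ⟨e1, e2⟩ | ⟨e1, e2⟩ | ⟨e1, e2⟩ <;>
    rw [dirDot, e1, e2] <;> push_cast <;> linarith

/-- Two indices in `Fin 4` differ by `0`, `1`, `2` or `3` quarter turns. -/
theorem dirDot_cases (j k : Fin 4) (z z' : ℂ) :
    k = j ∨ (dirDot k z = dirDot (j + 1) z ∧ dirDot k z' = dirDot (j + 1) z') ∨
    (dirDot k z = -dirDot j z ∧ dirDot k z' = -dirDot j z') ∨
    (dirDot k z = -dirDot (j + 1) z ∧ dirDot k z' = -dirDot (j + 1) z') := by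
  fin_cases j <;> fin_cases k <;>
    simp [dirDot, dir]

/-- The set `N_1` on pairs of conjugates: the fibre condition, with strict inequality at the
unit circle. -/
theorem mem_N1_iff {z z' : ℂ} (hX : z ∈ closure X) (h : ConjPair z z') :
    (z, z') ∈ N1 ↔ InDual z z' ∧ 1 / 2 < halfSq z' := by
  have hz : halfSq z < 1 / 2 :=
    sq_lt_half_of_irrational hX fun h' => h.irrational (gaussInt_subset_Qi h')
  have hz0 : 0 < halfSq z := coords_sq_pos h.ne_zero
  simp only [N1, Set.mem_union, Set.mem_iUnion, Set.mem_prod]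
  constructor
  · rintro (((⟨j, hj, hj'⟩ | ⟨j, hj, hj'⟩) | ⟨j, hj, hj'⟩) | ⟨j, hj, hj'⟩)
    · rw [mem_XA] at hj
      rw [mem_WA, dist_dir_sq] at hj'
      have h0 := hj.2 0 (by norm_num)
      have h1 := hj.2 1 (by norm_num)
      have h2 := hj.2 2 (by norm_num)
      rw [zero_add] at h0
      rw [show 1 + (j : ℕ) + 1 = j + 2 by ring, dirDot_add_two] at h1
      rw [show 2 + (j : ℕ) + 1 = j + 1 + 2 by ring, dirDot_add_two] at h2
      refine ⟨inDual_iff_dirDot.2 ⟨hj'.1.le, fun k hk => ?_⟩, hj'.1⟩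
      rcases dirDot_cases j k z z' with rfl | ⟨e, e'⟩ | ⟨e, e'⟩ | ⟨e, e'⟩
      · linarith [hj'.2]
      all_goals linarith
    · rw [mem_XB] at hj
      rw [mem_WB] at hj'
      simp only [dist_dir_sq] at hj'
      have h0 := hj.2 0 (by norm_num)
      have h1 := hj.2 1 (by norm_num)
      have h0' := hj'.2 0 (by norm_num)
      have h1' := hj'.2 1 (by norm_num)
      rw [zero_add] at h0 h0'
      rw [add_comm 1 (j : ℕ)] at h1 h1'
      refine ⟨inDual_iff_dirDot.2 ⟨hj'.1.le, fun k hk => ?_⟩, hj'.1⟩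
      rcases dirDot_cases j k z z' with rfl | ⟨e, e'⟩ | ⟨e, e'⟩ | ⟨e, e'⟩ <;> linarith
    · rw [mem_Y] at hj
      rw [mem_Y'] at hj'
      have hs : 1 / 2 < halfSq z' := lt_of_le_of_ne hj'.2 fun h' => by
        have := h.symm.halfSq_eq_half h'.symm
        linarith
      refine ⟨inDual_iff_dirDot.2 ⟨hj'.2, fun k hk => ?_⟩, hs⟩
      have e1 := dirDot_sq_add j z
      rw [hj.1] at e1
      rcases dirDot_cases j k z z' with rfl | ⟨e, e'⟩ | ⟨e, e'⟩ | ⟨e, e'⟩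
      · linarith [hj'.1]
      -- On the edge `halfSq z` is 1/4 + t² with t = `dirDot (j + 1) z`, so z is not inside an
      -- adjacent disc, since (t - 1/2)² ≥ 0.
      · nlinarith [sq_nonneg (dirDot (j + 1) z - 1 / 2)]
      · linarith [hj.1]
      · nlinarith [sq_nonneg (dirDot (j + 1) z + 1 / 2)]
    · rw [mem_K] at hj
      rw [mem_K'] at hj'
      refine ⟨inDual_iff_dirDot.2 ⟨hj'.2.le, fun k hk => ?_⟩, hj'.2⟩
      have e1 := dirDot_sq_add j z'
      rcases dirDot_cases j k z z' with rfl | ⟨e, e'⟩ | ⟨e, e'⟩ | ⟨e, e'⟩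
      · linarith [hj.1]
      -- With h = `halfSq z'`, the circle gives `dirDot (j + 1) z'` squared equal to h - h² ≤ 1/4,
      -- while h > 1/2.
      · rw [e']; nlinarith [hj'.1, hj'.2]
      · linarith [hj.1]
      · rw [e']; nlinarith [hj'.1, hj'.2]
  · rintro ⟨hD, hs⟩
    rw [inDual_iff_dirDot] at hD
    by_cases hK : ∃ k : Fin 4, halfSq z = dirDot k z
    · obtain ⟨k, hk⟩ := hK
      exact Or.inr ⟨k, mem_K.2 ⟨hk, hz.le⟩, mem_K'.2 ⟨h.halfSq_eq_dirDot hk, hs⟩⟩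
    push Not at hK
    by_cases hY : ∃ k : Fin 4, dirDot k z = 1 / 2
    · obtain ⟨k, hk⟩ := hY
      exact Or.inl (Or.inr ⟨k, mem_Y.2 ⟨hk, hz.le⟩, mem_Y'.2 ⟨h.dirDot_eq_half hk, hs.le⟩⟩)
    push Not at hY
    have hzX : z ∈ X := by
      obtain ⟨⟨h1, h2⟩, h3, h4⟩ := mem_closure_X.1 hX
      have h5 := hY 1
      have h6 := hY 0
      rw [show ((1 : Fin 4) : ℕ) = 1 from rfl, dirDot_one] at h5
      rw [show ((0 : Fin 4) : ℕ) = 0 from rfl, dirDot_zero] at h6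
      exact mem_X.2 ⟨⟨h1, lt_of_le_of_ne h2 h5⟩, h3, lt_of_le_of_ne h4 h6⟩
    -- Take the direction with the largest component. Then `halfSq z` ≤ 2(`dirDot j z`)² ≤ `dirDot j
    -- z`, so z lies in disc j, and besides it in at most one of the two adjacent discs.
    obtain ⟨j, hj⟩ : ∃ j : Fin 4, |dirDot (j + 1) z| ≤ dirDot j z := by
      rcases le_total |cu z| |cv z| with hc | hc
      · rcases le_total 0 (cv z) with h0 | h0
        · exact ⟨0, by simpa [dirDot_zero, dirDot_one, abs_of_nonneg h0] using hc⟩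
        · exact ⟨2, by simpa [dirDot_two, dirDot_three, abs_of_nonpos h0] using hc⟩
      · rcases le_total 0 (cu z) with h0 | h0
        · exact ⟨1, by simpa [dirDot_one, dirDot_two, abs_of_nonneg h0] using hc⟩
        · refine ⟨3, ?_⟩
          simpa [dirDot_three, dirDot_zero, dirDot_add_two 2, dirDot_two, abs_of_nonpos h0,
            show 3 + 1 = 2 + 2 from rfl] using hc
    have hj0 : 0 ≤ dirDot j z := (abs_nonneg _).trans hj
    have hj1 := dirDot_le_half hX j
    have hsq := dirDot_sq_add j z
    have hjlt : halfSq z < dirDot j z := by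
      refine lt_of_le_of_ne ?_ (hK j)
      have := sq_le_sq' (by linarith [abs_nonneg (dirDot (j + 1) z)]) hj
      rw [sq_abs] at this
      nlinarith
    have hjX := hD.2 j hjlt
    have hKn (n : ℕ) : halfSq z ≠ dirDot n z := by
      obtain ⟨k, hk⟩ := exists_dir_eq (dir_sq n)
      have := hK k
      rwa [dirDot, hk] at this
    rcases lt_trichotomy (dirDot (j + 1) z) (halfSq z) with h1 | h1 | h1
    · rcases lt_trichotomy (-dirDot (j + 1) z) (halfSq z) with h2 | h2 | h2
      · refine Or.inl (Or.inl (Or.inl ⟨j, mem_XA.2 ⟨hzX, fun k hk => ?_⟩, mem_WA.2 ⟨hs, ?_⟩⟩))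
        · interval_cases k
          · rwa [zero_add]
          · rw [show 1 + (j : ℕ) + 1 = j + 2 by ring, dirDot_add_two]; linarith
          · rwa [show 2 + (j : ℕ) + 1 = j + 1 + 2 by ring, dirDot_add_two]
        · rw [dist_dir_sq]; linarith
      · rw [← dirDot_add_two] at h2
        exact absurd h2.symm (hKn _)
      -- The other disc is the one preceding j cyclically, so the index of `XB` is k = j - 1 modulo
      -- 4.
      · obtain ⟨k, hk⟩ := exists_dir_eq (dir_sq (j + 1 + 2))
        have ek (y : ℂ) : dirDot k y = -dirDot (j + 1) y := by
          rw [← dirDot_add_two, dirDot, hk, dirDot]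
        have ek' (y : ℂ) : dirDot (k + 1) y = dirDot j y := by
          simp only [dirDot, dir, hk]; push_cast; ring
        have hkX := hD.2 k (by rwa [ek])
        refine Or.inl (Or.inl (Or.inr ⟨k, mem_XB.2 ⟨hzX, fun i hi => ?_⟩,
          mem_WB.2 ⟨hs, fun i hi => ?_⟩⟩))
        · interval_cases i
          · rwa [zero_add, ek]
          · rwa [add_comm, ek']
        · rw [dist_dir_sq]
          interval_cases i
          · rw [zero_add]; linarith
          · rw [add_comm 1 (k : ℕ), ek']; linarith
    · exact absurd h1.symm (hKn _)
    · obtain ⟨k, hk⟩ := exists_dir_eq (dir_sq (j + 1))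
      have ek (y : ℂ) : dirDot k y = dirDot (j + 1) y := by rw [dirDot, hk, dirDot]
      have hkX := hD.2 k (by rwa [ek])
      rw [ek] at hkX
      refine Or.inl (Or.inl (Or.inr ⟨j, mem_XB.2 ⟨hzX, fun i hi => ?_⟩,
        mem_WB.2 ⟨hs, fun i hi => ?_⟩⟩))
      · interval_cases i
        · rwa [zero_add]
        · rwa [add_comm]
      · rw [dist_dir_sq]
        interval_cases i
        · rw [zero_add]; linarith
        · rw [add_comm 1 (j : ℕ)]; linarith

/-! ### Finiteness of reduced pairs of a given discriminant. -/

/-- The Gaussian integers as a subring of `ℂ`. -/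
def gaussRing : Subring ℂ := GaussianInt.toComplex.range

theorem mem_gaussRing {z : ℂ} : z ∈ gaussRing ↔ z ∈ gaussInt := by
  constructor
  · rintro ⟨g, rfl⟩
    exact ⟨g.re, g.im, GaussianInt.toComplex_def g⟩
  · rintro ⟨m, n, rfl⟩
    exact ⟨⟨m, n⟩, by simp [GaussianInt.toComplex_def]⟩

theorem I_mem_gaussRing : I ∈ gaussRing := mem_gaussRing.2 ⟨0, 1, by simp⟩

theorem one_le_norm_of_mem_gaussRing {z : ℂ} (hz : z ∈ gaussRing) (h0 : z ≠ 0) : 1 ≤ ‖z‖ := by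
  obtain ⟨m, n, rfl⟩ := mem_gaussRing.1 hz
  rw [← one_le_sq_iff₀ (norm_nonneg _), Complex.sq_norm, Complex.normSq_apply]
  have h : m ≠ 0 ∨ n ≠ 0 := by
    by_contra! h
    simp [h.1, h.2] at h0
  have : 0 < m * m + n * n := by
    rcases h with h | h
    · nlinarith [mul_self_pos.2 h, mul_self_nonneg n]
    · nlinarith [mul_self_pos.2 h, mul_self_nonneg m]
  simp
  exact_mod_cast this

theorem finite_gaussRing_norm_le (R : ℝ) : {z : ℂ | z ∈ gaussRing ∧ ‖z‖ ≤ R}.Finite := by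
  refine (((Set.finite_Icc (-⌈R⌉) ⌈R⌉).prod (Set.finite_Icc (-⌈R⌉) ⌈R⌉)).image
    fun p : ℤ × ℤ => (p.1 + p.2 * I : ℂ)).subset ?_
  rintro z ⟨hz, hR⟩
  obtain ⟨m, n, rfl⟩ := mem_gaussRing.1 hz
  have h1 := (Complex.abs_re_le_norm _).trans hR
  have h2 := (Complex.abs_im_le_norm _).trans hR
  simp at h1 h2
  have hc := Int.le_ceil R
  refine ⟨(m, n), ⟨?_, ?_⟩, rfl⟩ <;> rw [Set.mem_Icc, ← abs_le]
  · exact_mod_cast h1.trans hc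
  · exact_mod_cast h2.trans hc

theorem exists_int_mul_mem_gaussRing {z : ℂ} (h : z ∈ Qi) :
    ∃ n : ℤ, n ≠ 0 ∧ (n : ℂ) * z ∈ gaussRing := by
  obtain ⟨r, s, rfl⟩ := mem_Qi_iff.1 h
  refine ⟨r.den * s.den, by positivity, mem_gaussRing.2 ⟨s.den * r.num, r.den * s.num, ?_⟩⟩
  have hr : (r.den : ℂ) * r = r.num := by exact_mod_cast r.den_mul_eq_num
  have hs : (s.den : ℂ) * s = s.num := by exact_mod_cast s.den_mul_eq_num
  push_cast
  linear_combination (s.den : ℂ) * hr + (r.den : ℂ) * I * hs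

/-- `z` and `z'` are the roots of a quadratic polynomial over `ℤ[i]` of discriminant `D`. -/
def HasDiscr (D z z' : ℂ) : Prop :=
  ∃ a ∈ gaussRing, ∃ b ∈ gaussRing, ∃ c ∈ gaussRing,
    a ≠ 0 ∧ a * (z + z') = -b ∧ a * (z * z') = c ∧ b ^ 2 - 4 * (a * c) = D

theorem ConjPair.exists_hasDiscr {z z' : ℂ} (h : ConjPair z z') : ∃ D, HasDiscr D z z' := by
  obtain ⟨m, hm, hm'⟩ := exists_int_mul_mem_gaussRing h.add_mem_Qi
  obtain ⟨n, hn, hn'⟩ := exists_int_mul_mem_gaussRing h.mul_mem_Qi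
  refine ⟨_, m * n, mul_mem (intCast_mem _ m) (intCast_mem _ n), -(n * (m * (z + z'))),
    neg_mem (mul_mem (intCast_mem _ n) hm'), m * (n * (z * z')), mul_mem (intCast_mem _ m) hn',
    mul_ne_zero (by exact_mod_cast hm) (by exact_mod_cast hn), by ring, by ring, rfl⟩

/-- Substituting z = 1/(t + w) turns the form (a, b, c) into (c, b + 2wc, a + wb + w²c); the
substitution has determinant -1. -/
theorem HasDiscr.inv_sub {D z z' w : ℂ} (h : HasDiscr D z z') (hz : z ≠ 0) (hz' : z' ≠ 0)
    (hw : w ∈ gaussRing) : HasDiscr D (1 / z - w) (1 / z' - w) := by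
  obtain ⟨a, ha, b, hb, c, hc, h0, e1, e2, e3⟩ := h
  refine ⟨c, hc, b + 2 * (w * c), ?_, a + w * b + w ^ 2 * c, ?_, ?_, ?_, ?_, ?_⟩
  · exact add_mem hb (mul_mem (ofNat_mem _ 2) (mul_mem hw hc))
  · exact add_mem (add_mem ha (mul_mem hw hb)) (mul_mem (pow_mem hw 2) hc)
  · rw [← e2]; exact mul_ne_zero h0 (mul_ne_zero hz hz')
  · rw [← e2, ← neg_eq_iff_eq_neg.2 e1]; field_simp; ring
  · rw [← e2, ← neg_eq_iff_eq_neg.2 e1]; field_simp; ring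
  · linear_combination e3

/-- This treats the quarter of the square next to the vertex 1. For x ≥ 1/2 the bound |y| ≤ 1 - x
suffices; for x ≤ 1/2 the right side is at least 1. -/
theorem sector_bound {x y : ℝ} (h1 : |y| ≤ x) (h2 : x + |y| ≤ 1) :
    (1 - x) ^ 2 + y ^ 2 ≤ (2 * (1 - (x ^ 2 + y ^ 2))) ^ 2 := by
  rw [← sq_abs y]
  have h0 := abs_nonneg y
  set t := |y|
  have hx : x ^ 2 + t ^ 2 ≤ 1 - 2 * (x * (1 - x)) := by nlinarith
  rcases le_total (1 / 2) x with h | h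
  · have h3 : (1 - x) ≤ 1 - (x ^ 2 + t ^ 2) := by nlinarith
    have h4 : 0 ≤ 1 - x := by linarith
    nlinarith [mul_self_le_mul_self h4 h3]
  · have h3 : 1 / 2 ≤ 1 - (x ^ 2 + t ^ 2) := by nlinarith
    have h4 : (1 - x) ^ 2 + t ^ 2 ≤ 1 := by nlinarith
    nlinarith

/-- The distance of a point of the square from the nearest vertex is controlled by its distance
from the unit circle. -/
theorem exists_vertex_near {z : ℂ} (h : z ∈ closure X) :
    ∃ e ∈ gaussRing, ‖e - z‖ ≤ 4 * (1 - ‖z‖) := by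
  obtain ⟨⟨h1, h2⟩, h3, h4⟩ := mem_closure_X.1 h
  simp only [cu, cv] at h1 h2 h3 h4
  have aux {e : ℂ} {x y : ℝ} (hxy : |y| ≤ x) (hxy' : x + |y| ≤ 1)
      (hz : ‖z‖ ^ 2 = x ^ 2 + y ^ 2) (he : ‖e - z‖ ^ 2 = (1 - x) ^ 2 + y ^ 2) :
      ‖e - z‖ ≤ 4 * (1 - ‖z‖) := by
    have hle : x ^ 2 + y ^ 2 ≤ 1 := by nlinarith [sq_abs y, abs_nonneg y]
    have hn : ‖z‖ ≤ 1 := by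
      rw [← hz] at hle
      exact (sq_le_one_iff₀ (norm_nonneg z)).1 hle
    have hb := sector_bound hxy hxy'
    rw [← he, ← hz] at hb
    have := (sq_le_sq₀ (norm_nonneg _) (by linarith)).1 hb
    nlinarith [norm_nonneg z]
  have hz := Complex.sq_norm z
  rw [Complex.normSq_apply] at hz
  rcases le_total |z.im| |z.re| with hc | hc
  · rcases le_total 0 z.re with h0 | h0
    · rw [abs_of_nonneg h0] at hc
      refine ⟨1, one_mem _, aux hc ?_ (by linarith) ?_⟩
      · rcases abs_cases z.im with ⟨e, -⟩ | ⟨e, -⟩ <;> linarith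
      · rw [Complex.sq_norm, Complex.normSq_apply]; simp; ring
    · rw [abs_of_nonpos h0] at hc
      refine ⟨-1, neg_mem (one_mem _), aux hc ?_ (by linarith) ?_⟩
      · rcases abs_cases z.im with ⟨e, -⟩ | ⟨e, -⟩ <;> linarith
      · rw [Complex.sq_norm, Complex.normSq_apply]; simp; ring
  · rcases le_total 0 z.im with h0 | h0
    · rw [abs_of_nonneg h0] at hc
      refine ⟨I, I_mem_gaussRing, aux hc ?_ (by linarith) ?_⟩
      · rcases abs_cases z.re with ⟨e, -⟩ | ⟨e, -⟩ <;> linarith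
      · rw [Complex.sq_norm, Complex.normSq_apply]; simp; ring
    · rw [abs_of_nonpos h0] at hc
      refine ⟨-I, neg_mem I_mem_gaussRing, aux hc ?_ (by linarith) ?_⟩
      · rcases abs_cases z.re with ⟨e, -⟩ | ⟨e, -⟩ <;> linarith
      · rw [Complex.sq_norm, Complex.normSq_apply]; simp; ring

theorem gaussRing_subset_Qi {z : ℂ} (h : z ∈ gaussRing) : z ∈ Qi :=
  gaussInt_subset_Qi (mem_gaussRing.1 h)

/-- Bound for the leading coefficient of a reduced form in terms of its discriminant. -/
theorem norm_leading_le {z z' a b c D : ℂ} (hX : z ∈ closure X) (h1 : 1 ≤ ‖z'‖)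
    (h : ConjPair z z') (ha : a ∈ gaussRing) (hb : b ∈ gaussRing) (hc : c ∈ gaussRing)
    (h0 : a ≠ 0) (e1 : a * (z + z') = -b) (e2 : a * (z * z') = c)
    (e3 : b ^ 2 - 4 * (a * c) = D) : ‖a‖ ≤ 20 * ‖D‖ := by
  obtain ⟨e, he, hez⟩ := exists_vertex_near hX
  -- The value of the quadratic form at e is a nonzero Gaussian integer, so its norm is at least 1.
  -- Both root distances are controlled by |z - z'|, and a²(z - z')² = D.
  have hf : a * ((e - z) * (e - z')) ∈ gaussRing := by
    have : a * ((e - z) * (e - z')) = a * e ^ 2 + b * e + c := by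
      linear_combination -e * e1 + e2
    rw [this]
    exact add_mem (add_mem (mul_mem ha (pow_mem he 2)) (mul_mem hb he)) hc
  have hne : a * ((e - z) * (e - z')) ≠ 0 := by
    refine mul_ne_zero h0 (mul_ne_zero (sub_ne_zero.2 ?_) (sub_ne_zero.2 ?_))
    · rintro rfl; exact h.irrational (gaussRing_subset_Qi he)
    · rintro rfl; exact h.symm.irrational (gaussRing_subset_Qi he)
  have key := one_le_norm_of_mem_gaussRing hf hne
  rw [norm_mul, norm_mul] at key
  have hd : ‖a‖ ^ 2 * ‖z - z'‖ ^ 2 = ‖D‖ := by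
    rw [← norm_pow, ← norm_pow, ← norm_mul, ← e3]
    congr 1
    linear_combination (a * (z + z') - b) * e1 - 4 * a * e2
  have t1 : 1 - ‖z‖ ≤ ‖z - z'‖ := by
    have := norm_sub_norm_le z' z
    rw [norm_sub_rev] at this
    linarith
  have t2 : ‖e - z'‖ ≤ ‖e - z‖ + ‖z - z'‖ := by
    have := norm_add_le (e - z) (z - z')
    simpa using this
  have p1 : ‖e - z‖ ≤ 4 * ‖z - z'‖ := by linarith
  have p2 : ‖e - z'‖ ≤ 5 * ‖z - z'‖ := by linarith
  have p3 : ‖e - z‖ * ‖e - z'‖ ≤ (4 * ‖z - z'‖) * (5 * ‖z - z'‖) :=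
    mul_le_mul p1 p2 (norm_nonneg _) (by positivity)
  have p4 : 1 ≤ ‖a‖ * ((4 * ‖z - z'‖) * (5 * ‖z - z'‖)) :=
    key.trans (mul_le_mul_of_nonneg_left p3 (norm_nonneg a))
  nlinarith [mul_le_mul_of_nonneg_left p4 (norm_nonneg a)]

/-- Both coefficients are expressed through az and a(z' - z), whose square has norm |D|; this works
even when z' is large. -/
theorem norm_coeffs_le {z z' a b c D : ℂ} (hz : ‖z‖ ≤ 1) (e1 : a * (z + z') = -b)
    (e2 : a * (z * z') = c) (e3 : b ^ 2 - 4 * (a * c) = D) :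
    ‖b‖ ≤ 2 * ‖a‖ + (‖D‖ + 1) ∧ ‖c‖ ≤ ‖a‖ + (‖D‖ + 1) := by
  have hd : ‖a * (z' - z)‖ ^ 2 = ‖D‖ := by
    rw [← norm_pow, ← e3]
    congr 1
    linear_combination (a * (z + z') - b) * e1 - 4 * a * e2
  -- From t ≤ t² + 1, to avoid a square root of |D|.
  have hd' : ‖a * (z' - z)‖ ≤ ‖D‖ + 1 := by nlinarith [norm_nonneg (a * (z' - z))]
  have haz : ‖a * z‖ ≤ ‖a‖ := by
    rw [norm_mul]; exact mul_le_of_le_one_right (norm_nonneg a) hz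
  constructor
  · have : b = -(a * z + a * z + a * (z' - z)) := by linear_combination e1
    rw [this, norm_neg]
    refine (norm_add₃_le).trans ?_
    linarith
  · have : c = z * (a * z + a * (z' - z)) := by rw [← e2]; ring
    rw [this, norm_mul]
    refine (mul_le_of_le_one_left (norm_nonneg _) hz).trans ((norm_add_le _ _).trans ?_)
    linarith

/-- Only finitely many reduced pairs have a given discriminant. -/
theorem finite_reduced (D : ℂ) : {p : ℂ × ℂ | p.1 ∈ closure X ∧ ConjPair p.1 p.2 ∧
    1 ≤ ‖p.2‖ ∧ HasDiscr D p.1 p.2}.Finite := by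
  set R := 2 * (20 * ‖D‖) + (‖D‖ + 1)
  have hF := finite_gaussRing_norm_le R
  refine ((hF.prod (hF.prod hF)).biUnion (t := fun q : ℂ × ℂ × ℂ =>
    {p : ℂ × ℂ | q.1 ≠ 0 ∧ q.1 * (p.1 + p.2) = -q.2.1 ∧ q.1 * (p.1 * p.2) = q.2.2}) ?_).subset ?_
  · rintro ⟨a, b, c⟩ -
    by_cases h0 : a = 0
    · simp [h0]
    open Polynomial in
    set f : ℂ[X] := C a * Polynomial.X ^ 2 + C b * Polynomial.X + C c with hf
    have hdeg : f.natDegree = 2 := Polynomial.natDegree_quadratic h0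
    have hf0 : f ≠ 0 := by rintro h; rw [h] at hdeg; simp at hdeg
    have hr : {x | f.IsRoot x}.Finite := Polynomial.finite_setOfPred_isRoot hf0
    refine (hr.prod hr).subset ?_
    rintro ⟨z, z'⟩ ⟨-, e1, e2⟩
    simp only at e1 e2
    refine ⟨?_, ?_⟩ <;> simp only [Set.mem_ofPred_eq, Polynomial.IsRoot.def, hf,
      Polynomial.eval_add, Polynomial.eval_mul, Polynomial.eval_C, Polynomial.eval_X,
      Polynomial.eval_pow]
    · linear_combination z * e1 - e2
    · linear_combination z' * e1 - e2
  · rintro ⟨z, z'⟩ ⟨hX, h, h1, a, ha, b, hb, c, hc, h0, e1, e2, e3⟩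
    have hz : ‖z‖ ≤ 1 := by
      rw [norm_le_one_iff]
      exact (sq_lt_half_of_irrational hX fun h' => h.irrational (gaussInt_subset_Qi h')).le
    have hA := norm_leading_le hX h1 h ha hb hc h0 e1 e2 e3
    obtain ⟨hB, hC⟩ := norm_coeffs_le hz e1 e2 e3
    have := norm_nonneg D
    simp only [Set.mem_iUnion]
    exact ⟨(a, b, c), ⟨⟨ha, by linarith⟩, ⟨hb, by linarith⟩, hc, by linarith⟩, h0, e1, e2⟩

/-! ### Orbits as iterates, and the natural extension. -/

theorem orbit_eq_some {α : ℂ} {n : ℕ} (h : ∀ k < n, TH^[k] α ≠ 0) :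
    orbit α n = some (TH^[n] α) := by
  induction n with
  | zero => rfl
  | succ n ih =>
    rw [orbit, ih fun k hk => h k (by omega), Option.bind_some, step, if_neg (h n (by omega)),
      Function.iterate_succ_apply']

theorem iterate_ne_zero {α : ℂ} (h : ∀ n, orbit α n ≠ none) (n : ℕ) : TH^[n] α ≠ 0 := by
  induction n using Nat.strong_induction_on with
  | _ n ih =>
    intro h0
    apply h (n + 1)
    rw [orbit, orbit_eq_some ih, Option.bind_some, step, if_pos h0]

theorem purelyPeriodic_iff {α : ℂ} :
    PurelyPeriodic α ↔ (∀ n, TH^[n] α ≠ 0) ∧ ∃ p, 0 < p ∧ TH^[p] α = α := by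
  constructor
  · rintro ⟨h, p, hp, hper⟩
    have h0 := iterate_ne_zero h
    refine ⟨h0, p, hp, ?_⟩
    have := hper 0
    rw [zero_add, orbit_eq_some fun k _ => h0 k] at this
    exact Option.some.inj this
  · rintro ⟨h0, p, hp, hper⟩
    have h (n : ℕ) := orbit_eq_some (n := n) fun k _ => h0 k
    refine ⟨fun n => by rw [h]; simp, p, hp, fun n => ?_⟩
    rw [h, h, Function.iterate_add_apply, hper]

theorem TH_of_ne_zero {z : ℂ} (hz : z ≠ 0) : TH z = 1 / z - floorH (1 / z) := if_neg hz

/-- The natural extension of `TH`: the same Möbius map is applied to both components. -/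
def pairMap (p : ℂ × ℂ) : ℂ × ℂ := (1 / p.1 - floorH (1 / p.1), 1 / p.2 - floorH (1 / p.1))

theorem pairMap_iterate_fst {z : ℂ} (h : ∀ n, TH^[n] z ≠ 0) (z' : ℂ) (n : ℕ) :
    (pairMap^[n] (z, z')).1 = TH^[n] z := by
  induction n with
  | zero => rfl
  | succ n ih =>
    rw [Function.iterate_succ_apply', Function.iterate_succ_apply', TH_of_ne_zero (h n), pairMap,
      ih]

theorem ConjPair.inv_not_mem_gaussInt {z z' : ℂ} (h : ConjPair z z') : 1 / z ∉ gaussInt :=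
  fun h' => h.irrational (by simpa using inv_mem (gaussInt_subset_Qi h'))

/-! ### The natural extension permutes the reduced pairs. -/

/-- The reduced pairs of conjugates of discriminant `D`. -/
def reducedPairs (D : ℂ) : Set (ℂ × ℂ) :=
  {p | p.1 ∈ closure X ∧ ConjPair p.1 p.2 ∧ InDual p.1 p.2 ∧ 1 / 2 < halfSq p.2 ∧
    HasDiscr D p.1 p.2}

theorem ConjPair.halfSq_lt {z z' : ℂ} (h : ConjPair z z') (hX : z ∈ closure X) :
    halfSq z < 1 / 2 :=
  sq_lt_half_of_irrational hX fun h' => h.irrational (gaussInt_subset_Qi h')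

theorem ConjPair.half_lt_halfSq {z z' : ℂ} (h : ConjPair z z') (hX : z ∈ closure X)
    (hD : InDual z z') : 1 / 2 < halfSq z' :=
  lt_of_le_of_ne hD.one_le fun h' =>
    (h.halfSq_lt hX).ne (h.symm.halfSq_eq_half h'.symm)

theorem mapsTo_pairMap (D : ℂ) : Set.MapsTo pairMap (reducedPairs D) (reducedPairs D) := by
  rintro ⟨z, z'⟩ ⟨hX, h, hD, -, hd⟩
  have hr := isRounding_floorH h.inv_not_mem_gaussInt
  have hw := hr.mem_gaussInt
  have hX' := hr.sub_mem_closure_X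
  have h' := h.inv_sub (gaussInt_subset_Qi hw)
  have hD' := hD.map hX h.ne_zero (h.halfSq_lt hX) hr
  exact ⟨hX', h', hD', h'.half_lt_halfSq hX' hD',
    hd.inv_sub h.ne_zero h.symm.ne_zero (mem_gaussRing.2 hw)⟩

theorem injOn_pairMap (D : ℂ) : Set.InjOn pairMap (reducedPairs D) := by
  rintro ⟨z₁, z₁'⟩ ⟨-, h₁, hD₁, hs₁, -⟩ ⟨z₂, z₂'⟩ ⟨-, h₂, hD₂, hs₂, -⟩ he
  obtain ⟨e, e'⟩ := Prod.ext_iff.1 he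
  simp only [pairMap] at e e'
  have hw := hD₁.rounding_unique hD₂ h₁.ne_zero h₂.ne_zero hs₁ hs₂
    (isRounding_floorH h₁.inv_not_mem_gaussInt) (isRounding_floorH h₂.inv_not_mem_gaussInt) e e'
  rw [hw, sub_left_inj, one_div, one_div, inv_inj] at e e'
  exact Prod.ext e e'

theorem finite_reducedPairs (D : ℂ) : (reducedPairs D).Finite :=
  (finite_reduced D).subset fun _ hp =>
    ⟨hp.1, hp.2.1, one_le_norm_iff.2 hp.2.2.1.one_le, hp.2.2.2.2⟩

theorem purelyPeriodic_of_inDual {z z' : ℂ} (hX : z ∈ closure X) (h : ConjPair z z')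
    (hD : InDual z z') : PurelyPeriodic z := by
  obtain ⟨D, hd⟩ := h.exists_hasDiscr
  have hp : (z, z') ∈ reducedPairs D := ⟨hX, h, hD, h.half_lt_halfSq hX hD, hd⟩
  have hmaps := mapsTo_pairMap D
  have hfin : Finite (reducedPairs D) := finite_reducedPairs D
  -- Both claims are proved together: `pairMap` follows `TH` only while the terms are nonzero, and
  -- irrationality of the first entry keeps them so.
  have hne (n : ℕ) : TH^[n] z ≠ 0 ∧ (pairMap^[n] (z, z')).1 = TH^[n] z := by
    induction n with
    | zero => exact ⟨h.ne_zero, rfl⟩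
    | succ n ih =>
      have hmem := hmaps.iterate (n + 1) hp
      have e : (pairMap^[n + 1] (z, z')).1 = TH^[n + 1] z := by
        rw [Function.iterate_succ_apply', Function.iterate_succ_apply', TH_of_ne_zero ih.1,
          pairMap, ih.2]
      exact ⟨e ▸ hmem.2.1.ne_zero, e⟩
  refine purelyPeriodic_iff.2 ⟨fun n => (hne n).1, ?_⟩
  obtain ⟨p, hp0, hper⟩ := Function.mem_periodicPts.1 (Function.Injective.mem_periodicPts
    (f := hmaps.restrict) (hmaps.restrict_inj.2 (injOn_pairMap D)) ⟨(z, z'), hp⟩)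
  refine ⟨p, hp0, ?_⟩
  have e := congrArg Subtype.val hper
  rw [hmaps.iterate_restrict] at e
  rw [← (hne p).2]
  exact congrArg Prod.fst e

/-! ### Periodic orbits: quadratic equation and contraction towards the conjugate. -/

open Filter Topology

theorem ConjPair.unique {z z₁ z₂ : ℂ} (h₁ : ConjPair z z₁) (h₂ : ConjPair z z₂) : z₁ = z₂ := by
  have hs : z₁ - z₂ ∈ Qi := by simpa using sub_mem h₁.add_mem_Qi h₂.add_mem_Qi
  have hp : z * (z₁ - z₂) ∈ Qi := by
    simpa only [mul_sub] using sub_mem h₁.mul_mem_Qi h₂.mul_mem_Qi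
  by_contra hne
  have h0 := sub_ne_zero.2 hne
  apply h₁.irrational
  have : z = z * (z₁ - z₂) / (z₁ - z₂) := by field_simp
  rw [this]
  exact div_mem hp hs

section InfiniteOrbit

variable {α : ℂ}

theorem inv_iterate_not_mem_gaussInt (h : ∀ n, TH^[n] α ≠ 0) (n : ℕ) :
    1 / TH^[n] α ∉ gaussInt := by
  intro h'
  apply h (n + 1)
  rw [Function.iterate_succ_apply', TH_of_ne_zero (h n), floorH_of_mem h', sub_self]

theorem iterate_succ_eq (h : ∀ n, TH^[n] α ≠ 0) (n : ℕ) :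
    TH^[n + 1] α = 1 / TH^[n] α - floorH (1 / TH^[n] α) := by
  rw [Function.iterate_succ_apply', TH_of_ne_zero (h n)]

theorem isRounding_iterate (h : ∀ n, TH^[n] α ≠ 0) (n : ℕ) :
    IsRounding (1 / TH^[n] α) (floorH (1 / TH^[n] α)) :=
  isRounding_floorH (inv_iterate_not_mem_gaussInt h n)

theorem iterate_mem_closure_X (hX : α ∈ closure X) (h : ∀ n, TH^[n] α ≠ 0) (n : ℕ) :
    TH^[n] α ∈ closure X := by
  cases n with
  | zero => exact hX
  | succ n =>
    rw [iterate_succ_eq h]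
    exact (isRounding_iterate h n).sub_mem_closure_X

/-- A term of norm 1 would be a Gaussian unit; its inverse would be its own floor, and the orbit
would stop. -/
theorem halfSq_iterate_lt (hX : α ∈ closure X) (h : ∀ n, TH^[n] α ≠ 0) (n : ℕ) :
    halfSq (TH^[n] α) < 1 / 2 := by
  have hn := iterate_mem_closure_X hX h n
  refine sq_lt_half_of_irrational hn fun hg => inv_iterate_not_mem_gaussInt h n ?_
  have h1 := one_le_norm_of_mem_gaussRing (mem_gaussRing.2 hg) (h n)
  have h2 : ‖TH^[n] α‖ ≤ 1 := by
    rw [norm_le_one_iff]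
    obtain ⟨⟨h1, h2⟩, h3, h4⟩ := mem_closure_X.1 hn
    rw [halfSq]; nlinarith
  obtain ⟨a, b, hab⟩ := hg
  rw [one_div, Complex.inv_eq_conj (le_antisymm h2 h1), hab]
  exact ⟨a, -b, by simp⟩

theorem norm_iterate_lt (hX : α ∈ closure X) (h : ∀ n, TH^[n] α ≠ 0) (n : ℕ) :
    ‖TH^[n] α‖ < 1 := by
  rw [← not_le, one_le_norm_iff, not_le]
  exact halfSq_iterate_lt hX h n

/-- The product of the first `n` terms of the orbit. -/
def orbitProd (α : ℂ) (n : ℕ) : ℂ := ∏ i ∈ Finset.range n, TH^[i] α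

theorem orbitProd_succ (n : ℕ) : orbitProd α (n + 1) = orbitProd α n * TH^[n] α :=
  Finset.prod_range_succ _ _

theorem orbitProd_ne_zero (h : ∀ n, TH^[n] α ≠ 0) (n : ℕ) : orbitProd α n ≠ 0 :=
  Finset.prod_ne_zero_iff.2 fun i _ => h i

theorem norm_orbitProd_strictAnti (hX : α ∈ closure X) (h : ∀ n, TH^[n] α ≠ 0) :
    StrictAnti fun n => ‖orbitProd α n‖ :=
  strictAnti_nat_of_succ_lt fun n => by
    rw [orbitProd_succ, norm_mul]
    exact mul_lt_of_lt_one_right (norm_pos_iff.2 (orbitProd_ne_zero h n)) (norm_iterate_lt hX h n)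

theorem norm_orbitProd_lt_one (hX : α ∈ closure X) (h : ∀ n, TH^[n] α ≠ 0) {n : ℕ} (hn : 0 < n) :
    ‖orbitProd α n‖ < 1 := by
  have := norm_orbitProd_strictAnti hX h hn
  simpa [orbitProd] using this

/-- These products are the continued fraction remainders qα - p up to sign; they satisfy the
recurrence P(n+2) = P(n) - w P(n+1). -/
theorem orbitProd_linear (h : ∀ n, TH^[n] α ≠ 0) (n : ℕ) :
    (∃ a ∈ gaussRing, ∃ b ∈ gaussRing, orbitProd α n = a + b * α) ∧
      ∃ c ∈ gaussRing, ∃ d ∈ gaussRing, orbitProd α (n + 1) = c + d * α := by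
  induction n with
  | zero =>
    exact ⟨⟨1, one_mem _, 0, zero_mem _, by simp [orbitProd]⟩,
      0, zero_mem _, 1, one_mem _, by simp [orbitProd]⟩
  | succ n ih =>
    refine ⟨ih.2, ?_⟩
    obtain ⟨⟨a, ha, b, hb, e⟩, c, hc, d, hd, e'⟩ := ih
    have hw := mem_gaussRing.2 (isRounding_iterate h n).mem_gaussInt
    set w := floorH (1 / TH^[n] α)
    refine ⟨a - w * c, sub_mem ha (mul_mem hw hc), b - w * d, sub_mem hb (mul_mem hw hd), ?_⟩
    have : orbitProd α (n + 2) = orbitProd α n - w * orbitProd α (n + 1) := by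
      have hz := h n
      rw [orbitProd_succ, iterate_succ_eq h, orbitProd_succ]
      change _ * (1 / TH^[n] α - w) = _
      field_simp
    rw [this, e, e']
    ring

/-- If qα is a Gaussian integer, the multiples of the products by q are infinitely many distinct
Gaussian integers of bounded norm. -/
theorem not_mem_Qi_of_infinite (hX : α ∈ closure X) (h : ∀ n, TH^[n] α ≠ 0) : α ∉ Qi := by
  intro hα
  obtain ⟨q, hq, hqα⟩ := exists_int_mul_mem_gaussRing hα
  have hq' : (q : ℂ) ≠ 0 := by exact_mod_cast hq
  have hinj : Function.Injective fun n => (q : ℂ) * orbitProd α n := fun m n hmn =>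
    (norm_orbitProd_strictAnti hX h).injective
      (congrArg norm (mul_left_cancel₀ hq' hmn))
  refine Set.infinite_of_injective_forall_mem hinj (fun n => ?_)
    (finite_gaussRing_norm_le ‖(q : ℂ)‖)
  obtain ⟨⟨a, ha, b, hb, e⟩, -⟩ := orbitProd_linear h n
  refine ⟨?_, ?_⟩
  · have : (q : ℂ) * orbitProd α n = q * a + b * (q * α) := by rw [e]; ring
    change (q : ℂ) * orbitProd α n ∈ gaussRing
    rw [this]
    exact add_mem (mul_mem (intCast_mem _ q) ha) (mul_mem hb hqα)
  · rw [norm_mul]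
    refine mul_le_of_le_one_right (norm_nonneg _) ?_
    have := (norm_orbitProd_strictAnti hX h).antitone (Nat.zero_le n)
    simpa [orbitProd] using this

theorem exists_conjPair_of_periodic (hX : α ∈ closure X) (h : ∀ n, TH^[n] α ≠ 0) {p : ℕ}
    (hp : 0 < p) (hper : TH^[p] α = α) : ∃ α', ConjPair α α' := by
  obtain ⟨⟨a, ha, b, hb, e⟩, c, hc, d, hd, e'⟩ := orbitProd_linear h p
  rw [orbitProd_succ, hper, e] at e'
  -- Otherwise the product over one period is a nonzero Gaussian integer of norm below 1.
  have hb0 : b ≠ 0 := by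
    rintro rfl
    rw [zero_mul, add_zero] at e
    have h1 := one_le_norm_of_mem_gaussRing ha (e ▸ orbitProd_ne_zero h p)
    have h2 := norm_orbitProd_lt_one hX h hp
    rw [e] at h2
    linarith
  have key : b * α ^ 2 = (d - a) * α + c := by linear_combination e'
  replace ha := gaussRing_subset_Qi ha
  replace hb := gaussRing_subset_Qi hb
  replace hc := gaussRing_subset_Qi hc
  replace hd := gaussRing_subset_Qi hd
  refine ⟨(d - a) / b - α, not_mem_Qi_of_infinite hX h, ?_, ?_⟩
  · rw [add_sub_cancel]
    exact div_mem (sub_mem hd ha) hb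
  · have : α * ((d - a) / b - α) = -c / b := by
      field_simp
      linear_combination -key
    rw [this]
    exact div_mem (neg_mem hc) hb

theorem orbitProd_mul {p : ℕ} (hper : TH^[p] α = α) (k : ℕ) :
    orbitProd α (p * k) = orbitProd α p ^ k := by
  have hk (k i : ℕ) : TH^[p * k + i] α = TH^[i] α := by
    rw [add_comm, Function.iterate_add_apply]
    congr 1
    exact Function.IsPeriodicPt.mul_const (show Function.IsPeriodicPt TH p α from hper) k
  induction k with
  | zero => simp [orbitProd]
  | succ k ih =>
    rw [pow_succ, ← ih, mul_add_one, orbitProd, Finset.prod_range_add, ← orbitProd]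
    congr 1
    exact Finset.prod_congr rfl fun i _ => hk k i

theorem conjPair_iterate (h : ∀ n, TH^[n] α ≠ 0) {α' : ℂ} (hc : ConjPair α α') (n : ℕ) :
    ConjPair (TH^[n] α) (pairMap^[n] (α, α')).2 := by
  induction n with
  | zero => exact hc
  | succ n ih =>
    rw [iterate_succ_eq h, Function.iterate_succ_apply', pairMap, pairMap_iterate_fst h]
    exact ih.inv_sub (gaussInt_subset_Qi (isRounding_iterate h n).mem_gaussInt)

theorem inDual_iterate (hX : α ∈ closure X) (h : ∀ n, TH^[n] α ≠ 0) {β : ℂ} (hβ : InDual α β)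
    (n : ℕ) : InDual (TH^[n] α) (pairMap^[n] (α, β)).2 := by
  induction n with
  | zero => exact hβ
  | succ n ih =>
    rw [iterate_succ_eq h, Function.iterate_succ_apply', pairMap, pairMap_iterate_fst h]
    exact ih.map (iterate_mem_closure_X hX h n) (h n) (halfSq_iterate_lt hX h n)
      (isRounding_iterate h n)

/-- The distance from the orbit of an arbitrary point of the fibre to the orbit of the
conjugate, measured by a cross ratio, decays like the square of the product of the orbit. -/
theorem cross_ratio_iterate (hX : α ∈ closure X) (h : ∀ n, TH^[n] α ≠ 0) {α' β : ℂ}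
    (hc : ConjPair α α') (hβ : InDual α β) (n : ℕ) :
    ((pairMap^[n] (α, β)).2 - (pairMap^[n] (α, α')).2) * ((β - α) * (α' - α)) =
      (-1) ^ n * orbitProd α n ^ 2 * (β - α') *
        (((pairMap^[n] (α, β)).2 - TH^[n] α) * ((pairMap^[n] (α, α')).2 - TH^[n] α)) := by
  induction n with
  | zero => simp [orbitProd]
  | succ n ih =>
    have hz := h n
    have hz' := (conjPair_iterate h hc n).symm.ne_zero
    have hb : (pairMap^[n] (α, β)).2 ≠ 0 := by
      intro h0
      have := (inDual_iterate hX h hβ n).one_le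
      norm_num [h0, cu, cv] at this
    rw [iterate_succ_eq h, Function.iterate_succ_apply', Function.iterate_succ_apply', pairMap,
      pairMap, pairMap_iterate_fst h, pairMap_iterate_fst h, orbitProd_succ, pow_succ]
    simp only [sub_sub_sub_cancel_right]
    -- With current term z, one step multiplies (y - x)/((y - z)(x - z)) by -z².
    have e1 : 1 / (pairMap^[n] (α, β)).2 - 1 / (pairMap^[n] (α, α')).2 =
        -((pairMap^[n] (α, β)).2 - (pairMap^[n] (α, α')).2) /
          ((pairMap^[n] (α, β)).2 * (pairMap^[n] (α, α')).2) := by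
      field_simp; ring
    rw [e1, neg_div, neg_mul, div_mul_eq_mul_div, ih]
    field_simp
    ring

theorem InDual.of_tendsto {z y : ℂ} {f : ℕ → ℂ} (hf : ∀ n, InDual z (f n))
    (hy : Tendsto f atTop (𝓝 y)) : InDual z y := by
  have hu : Continuous cu := by unfold cu; fun_prop
  have hv : Continuous cv := by unfold cv; fun_prop
  have hu' := (hu.tendsto y).comp hy
  have hv' := (hv.tendsto y).comp hy
  refine ⟨ge_of_tendsto' ((hu'.pow 2).add (hv'.pow 2)) fun n => (hf n).one_le,
    fun a b hab hd => ge_of_tendsto' (((hu'.sub_const (a : ℝ)).pow 2).add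
      ((hv'.sub_const (b : ℝ)).pow 2)) fun n => (hf n).of_disc a b hab hd⟩

/-- A starting point far enough out to lie in every fibre. -/
theorem inDual_three (z : ℂ) : InDual z 3 := by
  refine ⟨by norm_num [cu, cv], fun a b hab _ => ?_⟩
  rcases sq_add_sq_eq_one hab with ⟨rfl, rfl⟩ | ⟨rfl, rfl⟩ | ⟨rfl, rfl⟩ | ⟨rfl, rfl⟩ <;>
    norm_num [cu, cv]

theorem inDual_of_periodic (hX : α ∈ closure X) (h : ∀ n, TH^[n] α ≠ 0) {p : ℕ}
    (hp : 0 < p) (hper : TH^[p] α = α) {α' : ℂ} (hc : ConjPair α α') : InDual α α' := by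
  have hk (k : ℕ) : TH^[p * k] α = α :=
    Function.IsPeriodicPt.mul_const (show Function.IsPeriodicPt TH p α from hper) k
  -- The conjugate is unique, so its orbit returns together with that of α.
  have hα' (k : ℕ) : (pairMap^[p * k] (α, α')).2 = α' := by
    have := conjPair_iterate h hc (p * k)
    rw [hk] at this
    exact this.unique hc
  set f : ℕ → ℂ := fun k => (pairMap^[p * k] (α, 3)).2 with hf
  have hD (k : ℕ) : InDual α (f k) := by
    have := inDual_iterate hX h (inDual_three α) (p * k)
    rwa [hk] at this
  have hlt : ‖α‖ < 1 := norm_iterate_lt hX h 0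
  have h3 : (3 : ℂ) - α ≠ 0 := by
    intro h0
    rw [← sub_eq_zero.1 h0] at hlt
    norm_num at hlt
  set r : ℕ → ℂ := fun k => (-1) ^ (p * k) * (orbitProd α p ^ k) ^ 2 * ((3 - α') / (3 - α)) with hr
  have hfr (k : ℕ) : f k - α' = r k * (f k - α) := by
    have := cross_ratio_iterate hX h hc (inDual_three α) (p * k)
    rw [hα', hk, orbitProd_mul hper] at this
    have ht : α' - α ≠ 0 := sub_ne_zero.2 hc.ne.symm
    simp only [hr, hf]
    rw [← mul_left_inj' (mul_ne_zero h3 ht), this]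
    field_simp
  have hr0 : Tendsto r atTop (𝓝 0) := by
    have h1 : Tendsto (fun k => ‖orbitProd α p‖ ^ k) atTop (𝓝 0) :=
      tendsto_pow_atTop_nhds_zero_of_lt_one (norm_nonneg _) (norm_orbitProd_lt_one hX h hp)
    rw [tendsto_zero_iff_norm_tendsto_zero]
    have h2 := (h1.pow 2).mul_const ‖(3 - α') / (3 - α)‖
    simpa [hr] using h2
  -- Solving `hfr` for `f k` gives this quotient, so no a priori bound on `f k` is needed.
  have hlim : Tendsto (fun k => (α' - r k * α) / (1 - r k)) atTop (𝓝 α') := by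
    have : Tendsto (fun k => (α' - r k * α) / (1 - r k)) atTop (𝓝 ((α' - 0 * α) / (1 - 0))) :=
      ((tendsto_const_nhds (x := α')).sub (hr0.mul_const α)).div
      ((tendsto_const_nhds (x := (1 : ℂ))).sub hr0) (by norm_num)
    simpa using this
  refine InDual.of_tendsto hD (hlim.congr fun k => ?_)
  have h1 : 1 - r k ≠ 0 := by
    intro h0
    apply hc.ne
    have h2 := hfr k
    rw [← sub_eq_zero.1 h0, one_mul, sub_right_inj] at h2
    exact h2.symm
  rw [div_eq_iff h1]
  linear_combination -hfr k

end InfiniteOrbit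

end JHurwitz

end

/-! ### The theorem. -/

theorem theorem6p2 (α : ℂ) (hα : α ∈ closure JHurwitz.X) :
    JHurwitz.PurelyPeriodic α ↔
      JHurwitz.IsQuadraticIrrational α ∧
        ∃ α' : ℂ, JHurwitz.IsConjugate α α' ∧ (α, α') ∈ JHurwitz.N1 := by
  constructor
  · intro h
    obtain ⟨h0, p, hp, hper⟩ := JHurwitz.purelyPeriodic_iff.1 h
    obtain ⟨α', hc⟩ := JHurwitz.exists_conjPair_of_periodic hα h0 hp hper
    have hD := JHurwitz.inDual_of_periodic hα h0 hp hper hc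
    exact ⟨hc.isQuadraticIrrational, α', hc.isConjugate,
      (JHurwitz.mem_N1_iff hα hc).2 ⟨hD, hc.half_lt_halfSq hα hD⟩⟩
  · rintro ⟨hq, α', hconj, hN⟩
    have hc := hq.conjPair hconj
    exact JHurwitz.purelyPeriodic_of_inDual hα hc ((JHurwitz.mem_N1_iff hα hc).1 hN).1
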